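/- Let $\omega>0$, $B>0$ and $\lambda<-2\omega$ be real numbers, and let $A=(A_1,A_2)\colon\mathbb{R}^2\to\mathbb{R}^2$ be a continuously differentiable vector potential of the homogeneous magnetic field of intensity $B$, i.e. $\partial_xA_2-\partial_yA_1=B$ on $\mathbb{R}^2$ (for instance $A=(0,Bx)$ or $A=(-By,0)$). The magnetic Smilansky–Solomyak operator $$H_{\mathrm{Sm}}(A)=(i\nabla+A)^2+\omega^2y^2+\lambda y\,\delta(x)$$ is defined in $L^2(\mathbb{R}^2)$ on the following initial domain $\mathcal{D}_0$: it consists of the functions $v\colon\mathbb{R}^2\to\mathbb{C}$ that are continuous on $\mathbb{R}^2$ and twice continuously differentiable on $\{x\neq0\}$, whose derivative $\partial_xv$ extends continuously from each of the open half-planes $\{x>0\}$ and $\{x<0\}$ to the line $x=0$, with boundary values satisfying $$\frac{\partial v}{\partial x}(0+,y)-\frac{\partial v}{\partial x}(0-,y)=\lambda\,y\,v(0,y)\qquad(y\in\mathbb{R}),$$ and for which both $v$ and the function $(i\nabla+A)^2v+\omega^2y^2v$, defined for $x\neq0$, belong to $L^2(\mathbb{R}^2)$; for $v\in\mathcal{D}_0$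 one sets $H_{\mathrm{Sm}}(A)v:=(i\nabla+A)^2v+\omega^2y^2v$ off the line $x=0$. Then every self-adjoint extension $T$ of $H_{\mathrm{Sm}}(A)\upharpoonright\mathcal{D}_0$ has spectrum $\sigma(T)=\mathbb{R}$. -/

import Mathlib

open MeasureTheory Set Filter Topology

noncomputable section

namespace Smilansky

/-- The Hilbert space `L²(ℝ²)` of complex-valued functions of `(x, y)`, with Lebesgue measure. -/
abbrev L2Plane : Type := Lp ℂ 2 (volume : Measure (ℝ × ℝ))

/-- The partial derivative `∂f/∂x` of a function of `p = (x, y)`. -/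
def dx {E : Type*} [NormedAddCommGroup E] [NormedSpace ℝ E] (f : ℝ × ℝ → E) (p : ℝ × ℝ) : E :=
  deriv (fun x : ℝ => f (x, p.2)) p.1

/-- The partial derivative `∂f/∂y` of a function of `p = (x, y)`. -/
def dy {E : Type*} [NormedAddCommGroup E] [NormedSpace ℝ E] (f : ℝ × ℝ → E) (p : ℝ × ℝ) : E :=
  deriv (fun y : ℝ => f (p.1, y)) p.2

/-- `A = (A₁, A₂)` is a continuously differentiable vector potential of the homogeneous magnetic
field of intensity `B`, that is, `∂A₂/∂x - ∂A₁/∂y = B` on the whole plane. -/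
structure IsVectorPotential (B : ℝ) (A : ℝ × ℝ → ℝ × ℝ) : Prop where
  contDiff : ContDiff ℝ 1 A
  curl_eq : ∀ p, dx (fun q => (A q).2) p - dy (fun q => (A q).1) p = B

/-- The first component `i ∂/∂x + A₁` of `i∇ + A`. -/
def magX (A : ℝ × ℝ → ℝ × ℝ) (v : ℝ × ℝ → ℂ) (p : ℝ × ℝ) : ℂ :=
  Complex.I * dx v p + ((A p).1 : ℂ) * v p

/-- The second component `i ∂/∂y + A₂` of `i∇ + A`. -/
def magY (A : ℝ × ℝ → ℝ × ℝ) (v : ℝ × ℝ → ℂ) (p : ℝ × ℝ) : ℂ :=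
  Complex.I * dy v p + ((A p).2 : ℂ) * v p

/-- The differential expression `(i∇ + A)² v + ω² y² v`. Away from the line `x = 0` it is the
action of the operator; its values on that line, a null set, are irrelevant. The interaction
`lam * y * δ(x)` enters through the matching condition in `MemD0`. -/
def hamiltonian (A : ℝ × ℝ → ℝ × ℝ) (ω : ℝ) (v : ℝ × ℝ → ℂ) (p : ℝ × ℝ) : ℂ :=
  magX A (magX A v) p + magY A (magY A v) p + ((ω ^ 2 * p.2 ^ 2 : ℝ) : ℂ) * v p

/-- The initial domain: the functions `v` that are continuous on the plane, twice continuously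
differentiable off the line `x = 0`, whose derivative `∂v/∂x` has continuous boundary values
`∂v/∂x(0+, y)` and `∂v/∂x(0-, y)` on this line from either side, with
`∂v/∂x(0+, y) - ∂v/∂x(0-, y) = lam * y * v(0, y)`, and for which the function itself and its image
under the differential expression are square integrable. -/
structure MemD0 (A : ℝ × ℝ → ℝ × ℝ) (ω lam : ℝ) (v : ℝ × ℝ → ℂ) : Prop where
  continuous : Continuous v
  contDiffOn : ContDiffOn ℝ 2 v {p | p.1 ≠ 0}
  matching : ∀ y : ℝ, ∃ a b : ℂ,
    Tendsto (dx v) (𝓝[{p | 0 < p.1}] (0, y)) (𝓝 a) ∧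
    Tendsto (dx v) (𝓝[{p | p.1 < 0}] (0, y)) (𝓝 b) ∧
    a - b = ((lam * y : ℝ) : ℂ) * v (0, y)
  memLp : MemLp v 2 (volume : Measure (ℝ × ℝ))
  memLp_hamiltonian : MemLp (hamiltonian A ω v) 2 (volume : Measure (ℝ × ℝ))

/-- The (possibly unbounded) operator `T` in `L²(ℝ²)` is a self-adjoint extension of the magnetic
Smilansky–Solomyak operator given on the initial domain. -/
structure IsSelfAdjointExtension (A : ℝ × ℝ → ℝ × ℝ) (ω lam : ℝ)
    (T : L2Plane →ₗ.[ℂ] L2Plane) : Prop where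
  isSelfAdjoint : IsSelfAdjoint T
  extends_D0 : ∀ (v : ℝ × ℝ → ℂ) (hv : MemD0 A ω lam v),
    ∃ h : hv.memLp.toLp v ∈ T.domain,
      T ⟨hv.memLp.toLp v, h⟩ = hv.memLp_hamiltonian.toLp (hamiltonian A ω v)

/-- `z` is in the resolvent set of the unbounded operator `T` if `T - z` maps the domain of `T`
bijectively onto the whole space and has a bounded inverse `R`. -/
def InResolventSet {H : Type*} [NormedAddCommGroup H] [NormedSpace ℂ H]
    (T : H →ₗ.[ℂ] H) (z : ℂ) : Prop :=
  ∃ R : H →L[ℂ] H,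
    (∀ u : H, ∃ h : R u ∈ T.domain, T ⟨R u, h⟩ - z • R u = u) ∧
    ∀ v : T.domain, R (T v - z • (v : H)) = (v : H)

/-- The spectrum of an unbounded operator: the complement in `ℂ` of the resolvent set. -/
def unboundedSpectrum {H : Type*} [NormedAddCommGroup H] [NormedSpace ℂ H]
    (T : H →ₗ.[ℂ] H) : Set ℂ :=
  {z | ¬ InResolventSet T z}

end Smilansky

end

noncomputable section

namespace Smilansky

/-! ### Self-adjoint operators: reality of the spectrum, and Weyl's criterion -/

section OperatorTheory

variable {H : Type*} [NormedAddCommGroup H] [InnerProductSpace ℂ H] [CompleteSpace H]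

open scoped InnerProductSpace ComplexConjugate

/-! A self-adjoint operator has real spectrum (`inResolventSet_of_im_ne_zero`). Conversely, every
extension `T` acts on the initial domain in the prescribed way, so it suffices to find approximate
eigenfunctions there for every real energy `μ` (`exists_approximate_eigenfunction`,
`not_inResolventSet_of_approx`).

Write `lam = -2a`. For large `y > 0` the transverse operator `-∂x² + lam y δ(x)` has the bound state
`exp(-a|x|y)` of energy `-a²y²`. Together with `ω²y²` this leaves the inverted oscillator `-∂y² -
κ²y²` with `κ² = a² - ω²`, and `κ` is real and nonzero because `lam < -2ω`. Its oscillating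
solutions `exp(iκy²/2) y^(-1/2 + iμ/(2κ))` exist at every real energy. The bound state has squared
norm of order `1/y`, so its normalization absorbs the factor `y^(-1/2)` and the amplitude is a
bounded function `h(log y)`; squared norms are then integrals against `dy/y`, i.e. lengths in `t =
log y`.

On the side `ε = ±1` of the line the exponent is taken to be `g = -εaxy + iκ(y² - x²)/2`. It is
harmonic, and `g_x² + g_y² = ω²(x² + y²)`: the `-x²` in the phase removes a cross term in `s = xy`,
which would not decay because `s` stays of order one. The magnetic field still produces the term
`-2Bκs`; it is removed by the amplitude corrections `εbx²` and `cx/y`, both of relative size `y⁻²`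
at fixed `s`. What remains is `-2iκh' - μh` plus `y⁻²` times a polynomial in `s` and `1/y`
(`actionAmplitude_sub`). The first part is made small by letting `h` be `exp(iμt/(2κ))` cut off
slowly to `[k, 2k]` (`exists_slow_wave`).

Thus the squared norm of the trial function is at least of order `k`, that of the residual at most
of order `1/k`, and `k` tends to infinity (`exists_trial_bounds`). A general vector potential costs
only a phase `exp(iφ)` (`IsVectorPotential.exists_gauge`). -/

theorem inner_apply_comm_of_isSelfAdjoint {T : H →ₗ.[ℂ] H} (hT : IsSelfAdjoint T)
    (v w : T.domain) : ⟪T v, (w : H)⟫_ℂ = ⟪(v : H), T w⟫_ℂ := by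
  have h := LinearPMap.adjoint_isFormalAdjoint hT.dense_domain
  rw [LinearPMap.isSelfAdjoint_def.1 hT] at h
  exact h v w

/-- The basic estimate `|Im z| ‖v‖ ≤ ‖(T - z) v‖` for a self-adjoint operator. -/
theorem abs_im_mul_norm_le {T : H →ₗ.[ℂ] H} (hT : IsSelfAdjoint T) (z : ℂ) (v : T.domain) :
    |z.im| * ‖(v : H)‖ ≤ ‖T v - z • (v : H)‖ := by
  have hreal : (⟪(v : H), T v⟫_ℂ).im = 0 := by
    have h1 := inner_apply_comm_of_isSelfAdjoint hT v v
    have h2 := inner_conj_symm (𝕜 := ℂ) (v : H) (T v)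
    rw [h1] at h2
    have := congrArg Complex.im h2
    rw [Complex.conj_im] at this
    linarith
  have him : (⟪(v : H), T v - z • (v : H)⟫_ℂ).im = -(z.im * ‖(v : H)‖ ^ 2) := by
    rw [inner_sub_right, inner_smul_right, inner_self_eq_norm_sq_to_K, Complex.sub_im, hreal]
    change 0 - (z * ((‖(v : H)‖ : ℝ) : ℂ) ^ 2).im = _
    rw [← Complex.ofReal_pow, Complex.im_mul_ofReal, zero_sub]
  have hle : |z.im| * ‖(v : H)‖ ^ 2 ≤ ‖(v : H)‖ * ‖T v - z • (v : H)‖ := by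
    calc |z.im| * ‖(v : H)‖ ^ 2 = |(⟪(v : H), T v - z • (v : H)⟫_ℂ).im| := by
          rw [him, abs_neg, abs_mul, abs_of_nonneg (sq_nonneg ‖(v : H)‖)]
      _ ≤ ‖⟪(v : H), T v - z • (v : H)⟫_ℂ‖ := Complex.abs_im_le_norm _
      _ ≤ _ := norm_inner_le_norm _ _
  rcases eq_or_lt_of_le (norm_nonneg (v : H)) with h0 | h0
  · rw [← h0]; simp
  · refine le_of_mul_le_mul_left ?_ h0
    nlinarith

/-- The basic estimate turns convergence of the images into convergence of the preimages, and the
graph of a self-adjoint operator is closed. -/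
theorem isClosed_range_sub_smul {T : H →ₗ.[ℂ] H} (hT : IsSelfAdjoint T) {z : ℂ}
    (hz : z.im ≠ 0) :
    IsClosed (LinearMap.range (T.toFun - z • T.domain.subtype) : Set H) := by
  have hpos : 0 < |z.im| := abs_pos.2 hz
  refine IsSeqClosed.isClosed fun u u₀ hu hlim => ?_
  choose v hv using hu
  have hv' : ∀ n, T (v n) - z • (v n : H) = u n := hv
  have hc : CauchySeq fun n => (v n : H) := by
    have hcu := hlim.cauchySeq
    rw [Metric.cauchySeq_iff] at hcu ⊢
    intro ε hε
    obtain ⟨N, hN⟩ := hcu (|z.im| * ε) (by positivity)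
    refine ⟨N, fun m hm n hn => ?_⟩
    have h1 := abs_im_mul_norm_le hT z (v m - v n)
    have h2 : T (v m - v n) - z • ((v m - v n : T.domain) : H) = u m - u n := by
      rw [LinearPMap.map_sub, ← hv' m, ← hv' n, Submodule.coe_sub, smul_sub]; abel
    have h3 := hN m hm n hn
    rw [h2, ← dist_eq_norm, Submodule.coe_sub, ← dist_eq_norm] at h1
    exact lt_of_mul_lt_mul_left (h1.trans_lt h3) hpos.le
  obtain ⟨v₀, hv₀⟩ := cauchySeq_tendsto_of_complete hc
  have hgraph : (v₀, u₀ + z • v₀) ∈ T.graph := by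
    have hcl : IsClosed (T.graph : Set (H × H)) := hT.isClosed
    refine hcl.mem_of_tendsto (hv₀.prodMk_nhds (hlim.add (hv₀.const_smul z)))
      (Eventually.of_forall fun n => ?_)
    have : u n + z • (v n : H) = T (v n) := by rw [← hv' n]; abel
    rw [this]
    exact T.mem_graph (v n)
  obtain ⟨w, hw1, hw2⟩ := (LinearPMap.mem_graph_iff T).1 hgraph
  refine ⟨w, ?_⟩
  change T w - z • (w : H) = u₀
  simp only at hw1 hw2
  rw [hw2, hw1]; abel

/-- A vector orthogonal to the range lies in the domain of the adjoint, hence of `T`, and is an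
eigenvector for `conj z`; the basic estimate at `conj z` forces it to vanish. -/
theorem orthogonal_range_sub_smul {T : H →ₗ.[ℂ] H} (hT : IsSelfAdjoint T) {z : ℂ}
    (hz : z.im ≠ 0) :
    (LinearMap.range (T.toFun - z • T.domain.subtype))ᗮ = ⊥ := by
  rw [Submodule.eq_bot_iff]
  intro w hw
  have hz' : (conj z).im ≠ 0 := by simpa using hz
  have h : ∀ x : T.domain, ⟪conj z • w, (x : H)⟫_ℂ = ⟪w, T x⟫_ℂ := by
    intro x
    have h1 : ⟪w, T x - z • (x : H)⟫_ℂ = 0 :=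
      (Submodule.mem_orthogonal' _ _).1 hw _ ⟨x, rfl⟩
    rw [inner_sub_right, inner_smul_right, sub_eq_zero] at h1
    rw [inner_smul_left, h1]; simp
  have hmem := LinearPMap.mem_adjoint_domain_of_exists w ⟨_, h⟩
  have happ := LinearPMap.adjoint_apply_eq hT.dense_domain ⟨w, hmem⟩ h
  -- Generalizing over `S` transports the eigenvector equation along `T† = T`, although the
  -- membership proof depends on the operator.
  have key : ∀ S : H →ₗ.[ℂ] H, S = T → ∀ hm : w ∈ S.domain, S ⟨w, hm⟩ = conj z • w → w = 0 := by
    rintro S rfl hm hS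
    have := abs_im_mul_norm_le hT (conj z) ⟨w, hm⟩
    rw [hS] at this
    simp only [sub_self, norm_zero] at this
    have h0 : ‖w‖ ≤ 0 := by
      by_contra! hcon
      exact absurd this (not_le.2 (mul_pos (abs_pos.2 hz') hcon))
    simpa using h0
  exact key _ (LinearPMap.isSelfAdjoint_def.1 hT) hmem happ

/-- The spectrum of a self-adjoint operator is real. -/
theorem inResolventSet_of_im_ne_zero {T : H →ₗ.[ℂ] H} (hT : IsSelfAdjoint T) {z : ℂ}
    (hz : z.im ≠ 0) : InResolventSet T z := by
  have hpos : 0 < |z.im| := abs_pos.2 hz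
  set L : T.domain →ₗ[ℂ] H := T.toFun - z • T.domain.subtype with hL
  have hLapp : ∀ v, L v = T v - z • (v : H) := fun v => rfl
  have hinj : Function.Injective L := by
    rw [← LinearMap.ker_eq_bot, LinearMap.ker_eq_bot']
    intro v hv
    have h1 := abs_im_mul_norm_le hT z v
    rw [← hLapp, hv, norm_zero] at h1
    have h0 : ‖(v : H)‖ ≤ 0 := by
      by_contra! hcon
      exact absurd h1 (not_le.2 (mul_pos hpos hcon))
    simpa using h0
  have hsurj : Function.Surjective L := by
    rw [← LinearMap.range_eq_top]
    have h1 := (Submodule.topologicalClosure_eq_top_iff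
      (K := LinearMap.range L)).2 (orthogonal_range_sub_smul hT hz)
    rwa [(isClosed_range_sub_smul hT hz).submodule_topologicalClosure_eq] at h1
  let e := LinearEquiv.ofBijective L ⟨hinj, hsurj⟩
  have he : ∀ u, L (e.symm u) = u := fun u => e.apply_symm_apply u
  refine ⟨(T.domain.subtype ∘ₗ e.symm.toLinearMap).mkContinuous |z.im|⁻¹ fun u => ?_,
    fun u => ⟨(e.symm u).2, ?_⟩, fun v => ?_⟩
  · have h1 := abs_im_mul_norm_le hT z (e.symm u)
    rw [← hLapp, he] at h1
    change ‖((e.symm u : T.domain) : H)‖ ≤ _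
    rw [inv_mul_eq_div, le_div_iff₀ hpos]
    linarith
  · exact he u
  · change ((e.symm (e v) : T.domain) : H) = v
    rw [e.symm_apply_apply]

end OperatorTheory

/-- A Weyl sequence for `z` shows that `z` is in the spectrum. -/
theorem not_inResolventSet_of_approx {H : Type*} [NormedAddCommGroup H] [NormedSpace ℂ H]
    {T : H →ₗ.[ℂ] H} {z : ℂ}
    (h : ∀ ε > 0, ∃ v : T.domain, (v : H) ≠ 0 ∧ ‖T v - z • (v : H)‖ ≤ ε * ‖(v : H)‖) :
    ¬ InResolventSet T z := by
  rintro ⟨R, -, hR⟩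
  have hpos : 0 < ‖R‖ + 1 := by positivity
  obtain ⟨v, hv, hle⟩ := h (‖R‖ + 1)⁻¹ (by positivity)
  have hv' : 0 < ‖(v : H)‖ := norm_pos_iff.2 hv
  have h1 : ‖(v : H)‖ ≤ ‖R‖ * ((‖R‖ + 1)⁻¹ * ‖(v : H)‖) := by
    calc ‖(v : H)‖ = ‖R (T v - z • (v : H))‖ := by rw [hR]
      _ ≤ ‖R‖ * ‖T v - z • (v : H)‖ := R.le_opNorm _
      _ ≤ _ := by gcongr
  have h2 : ‖R‖ * ((‖R‖ + 1)⁻¹ * ‖(v : H)‖) < ‖(v : H)‖ := by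
    rw [← mul_assoc, ← div_eq_mul_inv]
    have : ‖R‖ / (‖R‖ + 1) < 1 := by rw [div_lt_one hpos]; linarith
    nlinarith
  linarith


/-! ### Gauge transformation and locality of the differential expression -/

section Gauge

/-- Any vector potential of the homogeneous field differs from `(0, B x)` by a gradient. -/
theorem IsVectorPotential.exists_gauge {B : ℝ} {A : ℝ × ℝ → ℝ × ℝ}
    (hA : IsVectorPotential B A) :
    ∃ φ : ℝ × ℝ → ℝ, ContDiff ℝ 2 φ ∧
      (∀ p : ℝ × ℝ, HasDerivAt (fun x => φ (x, p.2)) (A p).1 p.1) ∧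
      ∀ p : ℝ × ℝ, HasDerivAt (fun y => φ (p.1, y)) ((A p).2 - B * p.1) p.2 := by
  let F : ℝ × ℝ → (ℝ × ℝ →L[ℝ] ℝ) := fun p =>
    (A p).1 • ContinuousLinearMap.fst ℝ ℝ ℝ +
      ((A p).2 - B * p.1) • ContinuousLinearMap.snd ℝ ℝ ℝ
  have hAd : ∀ p, HasFDerivAt A (fderiv ℝ A p) p := fun p =>
    (hA.contDiff.differentiable one_ne_zero p).hasFDerivAt
  have hAc := hA.contDiff
  have hF : ContDiff ℝ 1 F := by fun_prop
  have hFd : ∀ p v w, fderiv ℝ F p v w =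
      (fderiv ℝ A p v).1 * w.1 + ((fderiv ℝ A p v).2 - B * v.1) * w.2 := by
    intro p v w
    have h1 : HasFDerivAt (fun q => F q w)
        (w.1 • (ContinuousLinearMap.fst ℝ ℝ ℝ ∘L fderiv ℝ A p) +
          w.2 • (ContinuousLinearMap.snd ℝ ℝ ℝ ∘L fderiv ℝ A p -
            B • ContinuousLinearMap.fst ℝ ℝ ℝ)) p := by
      have ha := (hAd p).fst.mul_const w.1
      have hb := ((hAd p).snd.sub ((hasFDerivAt_fst (𝕜 := ℝ) (p := p)).const_mul B)).mul_const w.2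
      exact ha.add hb
    have h2 : HasFDerivAt (fun q => F q w) ((fderiv ℝ F p).flip w) p :=
      ((hF.differentiable one_ne_zero p).hasFDerivAt).clm_apply (hasFDerivAt_const w p) |>.congr_fderiv
        (by ext <;> simp)
    have h3 := congrArg (fun l => l v) (h2.unique h1)
    simp only [ContinuousLinearMap.flip_apply] at h3
    rw [h3]
    simp
    ring
  have hcurl : ∀ p, (fderiv ℝ A p (1, 0)).2 - (fderiv ℝ A p (0, 1)).1 = B := by
    intro p
    have hx : HasDerivAt (fun x : ℝ => (A (x, p.2)).2) (fderiv ℝ A p (1, 0)).2 p.1 := by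
      have h : HasFDerivAt (fun q => (A q).2)
        (ContinuousLinearMap.snd ℝ ℝ ℝ ∘L fderiv ℝ A p) p := (hAd p).snd
      have := h.comp_hasDerivAt p.1 ((hasDerivAt_id p.1).prodMk (hasDerivAt_const p.1 p.2))
      simpa [Function.comp_def] using this
    have hy : HasDerivAt (fun y : ℝ => (A (p.1, y)).1) (fderiv ℝ A p (0, 1)).1 p.2 := by
      have h : HasFDerivAt (fun q => (A q).1)
        (ContinuousLinearMap.fst ℝ ℝ ℝ ∘L fderiv ℝ A p) p := (hAd p).fst
      have := h.comp_hasDerivAt p.2 ((hasDerivAt_const p.2 p.1).prodMk (hasDerivAt_id p.2))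
      simpa [Function.comp_def] using this
    have := hA.curl_eq p
    rwa [dx, dy, hx.deriv, hy.deriv] at this
  -- The 1-form `F` is closed: the antisymmetric part of its derivative is `det(v, w)` times `curl A
  -- - B`.
  have hsymm : ∀ p v w, fderiv ℝ F p v w = fderiv ℝ F p w v := by
    intro p v w
    have hdec : ∀ v : ℝ × ℝ, fderiv ℝ A p v =
        v.1 • fderiv ℝ A p (1, 0) + v.2 • fderiv ℝ A p (0, 1) := by
      intro v
      rw [← map_smul, ← map_smul, ← map_add]
      simp
    rw [hFd, hFd, hdec v, hdec w]
    simp only [Prod.fst_add, Prod.snd_add, Prod.smul_fst, Prod.smul_snd, smul_eq_mul]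
    linear_combination (v.1 * w.2 - v.2 * w.1) * hcurl p
  obtain ⟨φ, hφ⟩ := convex_univ.exists_forall_hasFDerivAt_of_fderiv_symmetric isOpen_univ
    (hF.differentiable one_ne_zero).differentiableOn (fun p _ => hsymm p)
  refine ⟨φ, ?_, fun p => ?_, fun p => ?_⟩
  · exact contDiff_succ_iff_hasFDerivAt (n := 1).2 ⟨F, hF, fun p => hφ p (mem_univ p)⟩
  · have := (hφ p (mem_univ p)).comp_hasDerivAt p.1
      ((hasDerivAt_id p.1).prodMk (hasDerivAt_const p.1 p.2))
    simpa [F, Function.comp_def] using this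
  · have := (hφ p (mem_univ p)).comp_hasDerivAt p.2
      ((hasDerivAt_const p.2 p.1).prodMk (hasDerivAt_id p.2))
    simpa [F, Function.comp_def] using this

theorem hasDerivAt_cexp_mul {S Q : ℝ → ℂ} {S' Q' : ℂ} {t : ℝ} (hS : HasDerivAt S S' t)
    (hQ : HasDerivAt Q Q' t) :
    HasDerivAt (fun t => Complex.exp (S t) * Q t) (Complex.exp (S t) * (S' * Q t + Q')) t := by
  convert! hS.cexp.mul hQ using 1
  ring

/-- The summand `i A₁` in the derivative of the exponent becomes `-A₁` under `i∂/∂x` and cancels the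
potential. In the `y` direction the same cancellation leaves `b`, which will be `B x`. -/
theorem magX_cexp_mul {A : ℝ × ℝ → ℝ × ℝ} {Θ Q : ℝ × ℝ → ℂ} {p : ℝ × ℝ} {s q : ℂ}
    (hΘ : HasDerivAt (fun x => Θ (x, p.2)) (Complex.I * (A p).1 + s) p.1)
    (hQ : HasDerivAt (fun x => Q (x, p.2)) q p.1) :
    magX A (fun r => Complex.exp (Θ r) * Q r) p =
      Complex.exp (Θ p) * (Complex.I * (s * Q p + q)) := by
  rw [magX, dx, (hasDerivAt_cexp_mul hΘ hQ).deriv]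
  linear_combination (Complex.exp (Θ p) * (A p).1 * Q p) * Complex.I_sq

theorem magY_cexp_mul {A : ℝ × ℝ → ℝ × ℝ} {Θ Q : ℝ × ℝ → ℂ} {p : ℝ × ℝ} {s q b : ℂ}
    (hΘ : HasDerivAt (fun y => Θ (p.1, y)) (Complex.I * ((A p).2 - b) + s) p.2)
    (hQ : HasDerivAt (fun y => Q (p.1, y)) q p.2) :
    magY A (fun r => Complex.exp (Θ r) * Q r) p =
      Complex.exp (Θ p) * (Complex.I * (s * Q p + q) + b * Q p) := by
  rw [magY, dy, (hasDerivAt_cexp_mul hΘ hQ).deriv]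
  linear_combination (Complex.exp (Θ p) * ((A p).2 - b) * Q p) * Complex.I_sq

theorem dx_congr {v w : ℝ × ℝ → ℂ} {p : ℝ × ℝ} (h : v =ᶠ[𝓝 p] w) : dx v =ᶠ[𝓝 p] dx w := by
  filter_upwards [h.eventually_nhds] with q hq
  exact EventuallyEq.deriv_eq
    ((Continuous.tendsto' (f := fun x : ℝ => (x, q.2)) (by fun_prop) q.1 q rfl).eventually hq)

theorem dy_congr {v w : ℝ × ℝ → ℂ} {p : ℝ × ℝ} (h : v =ᶠ[𝓝 p] w) : dy v =ᶠ[𝓝 p] dy w := by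
  filter_upwards [h.eventually_nhds] with q hq
  exact EventuallyEq.deriv_eq
    ((Continuous.tendsto' (f := fun y : ℝ => (q.1, y)) (by fun_prop) q.2 q rfl).eventually hq)

theorem magX_congr (A : ℝ × ℝ → ℝ × ℝ) {v w : ℝ × ℝ → ℂ} {p : ℝ × ℝ} (h : v =ᶠ[𝓝 p] w) :
    magX A v =ᶠ[𝓝 p] magX A w := by
  filter_upwards [h, dx_congr h] with q h1 h2
  rw [magX, magX, h1, h2]

theorem magY_congr (A : ℝ × ℝ → ℝ × ℝ) {v w : ℝ × ℝ → ℂ} {p : ℝ × ℝ} (h : v =ᶠ[𝓝 p] w) :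
    magY A v =ᶠ[𝓝 p] magY A w := by
  filter_upwards [h, dy_congr h] with q h1 h2
  rw [magY, magY, h1, h2]

theorem hamiltonian_congr (A : ℝ × ℝ → ℝ × ℝ) (ω : ℝ) {v w : ℝ × ℝ → ℂ} {p : ℝ × ℝ}
    (h : v =ᶠ[𝓝 p] w) : hamiltonian A ω v p = hamiltonian A ω w p := by
  rw [hamiltonian, hamiltonian, (magX_congr A (magX_congr A h)).eq_of_nhds,
    (magY_congr A (magY_congr A h)).eq_of_nhds, h.eq_of_nhds]

end Gauge

/-! ### Functions of `log y` divided by powers of `y` -/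

section LogPull

/-- The function `h (log y) / y ^ n` on the half-line `y > 0`, extended by zero. -/
def logPull (h : ℝ → ℂ) (n : ℕ) (y : ℝ) : ℂ :=
  if 0 < y then h (Real.log y) / (y : ℂ) ^ n else 0

theorem logPull_of_pos (h : ℝ → ℂ) (n : ℕ) {y : ℝ} (hy : 0 < y) :
    logPull h n y = h (Real.log y) / (y : ℂ) ^ n := if_pos hy

theorem logPull_of_lt_one {h : ℝ → ℂ} (h0 : ∀ t < 0, h t = 0) (n : ℕ) {y : ℝ} (hy : y < 1) :
    logPull h n y = 0 := by
  rw [logPull]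
  split_ifs with hpos
  · rw [h0 _ (Real.log_neg hpos hy), zero_div]
  · rfl

/-- The quotient rule applies for `y > 0`, and the function is identically zero for `y < 1`; these
open sets cover the line, so extension by zero creates no singularity. -/
theorem hasDerivAt_logPull {h h' : ℝ → ℂ} (h0 : ∀ t < 0, h t = 0) (h0' : ∀ t < 0, h' t = 0)
    (hh : ∀ t, HasDerivAt h (h' t) t) (n : ℕ) (y : ℝ) :
    HasDerivAt (logPull h n) (logPull (fun t => h' t - n * h t) (n + 1) y) y := by
  rcases lt_or_ge 0 y with hy | hy
  · have hyc : (y : ℂ) ≠ 0 := by exact_mod_cast hy.ne'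
    have h1 : HasDerivAt (fun y : ℝ => h (Real.log y)) ((y⁻¹ : ℝ) • h' (Real.log y)) y :=
      (hh (Real.log y)).scomp y (Real.hasDerivAt_log hy.ne')
    have h2 : HasDerivAt (fun y : ℝ => (y : ℂ) ^ n) (n * (y : ℂ) ^ (n - 1) * 1) y :=
      (Complex.ofRealCLM.hasDerivAt (x := y)).pow n
    have h3 := h1.div h2 (pow_ne_zero n hyc)
    have h4 : logPull h n =ᶠ[𝓝 y] fun y : ℝ => h (Real.log y) / (y : ℂ) ^ n := by
      filter_upwards [lt_mem_nhds hy] with z hz using logPull_of_pos h n hz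
    refine (h3.congr_of_eventuallyEq h4).congr_deriv ?_
    rw [logPull_of_pos _ _ hy, Complex.real_smul]
    rcases n with _ | n
    · simp; field_simp
    · push_cast
      field_simp
      ring
  · have hy1 : y < 1 := by linarith
    have h4 : logPull h n =ᶠ[𝓝 y] fun _ => 0 := by
      filter_upwards [gt_mem_nhds hy1] with z hz using logPull_of_lt_one h0 n hz
    refine ((hasDerivAt_const y (0 : ℂ)).congr_of_eventuallyEq h4).congr_deriv ?_
    rw [logPull_of_lt_one (fun t ht => by rw [h0 t ht, h0' t ht]; simp) _ hy1]

theorem contDiff_logPull {h : ℝ → ℂ} (h0 : ∀ t < 0, h t = 0) {m : WithTop ℕ∞}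
    (hh : ContDiff ℝ m h) (n : ℕ) : ContDiff ℝ m (logPull h n) := by
  refine contDiff_iff_contDiffAt.2 fun y => ?_
  rcases lt_or_ge 0 y with hy | hy
  · have hyc : (y : ℂ) ≠ 0 := by exact_mod_cast hy.ne'
    have h4 : logPull h n =ᶠ[𝓝 y] fun y : ℝ => h (Real.log y) / (y : ℂ) ^ n := by
      filter_upwards [lt_mem_nhds hy] with z hz using logPull_of_pos h n hz
    refine ContDiffAt.congr_of_eventuallyEq ?_ h4
    have h1 : ContDiffAt ℝ m (fun y : ℝ => h (Real.log y)) y :=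
      hh.contDiffAt.comp y (Real.contDiffAt_log.2 hy.ne')
    have h2 : ContDiffAt ℝ m (fun y : ℝ => (y : ℂ) ^ n) y :=
      (Complex.ofRealCLM.contDiff.pow n).contDiffAt
    simp only [div_eq_mul_inv]
    exact h1.mul (h2.inv (pow_ne_zero n hyc))
  · have hy1 : y < 1 := by linarith
    have h4 : logPull h n =ᶠ[𝓝 y] fun _ => 0 := by
      filter_upwards [gt_mem_nhds hy1] with z hz using logPull_of_lt_one h0 n hz
    exact contDiffAt_const.congr_of_eventuallyEq h4

theorem logPull_of_notMem {h : ℝ → ℂ} {k l : ℝ} (h0 : ∀ t, t ∉ Icc k l → h t = 0) (n : ℕ)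
    {y : ℝ} (hy : y ∉ Icc (Real.exp k) (Real.exp l)) : logPull h n y = 0 := by
  rw [logPull]
  split_ifs with hpos
  · rw [h0, zero_div]
    rwa [mem_Icc, Real.le_log_iff_exp_le hpos, Real.log_le_iff_le_exp hpos]
  · rfl

end LogPull

/-! ### Slowly cut off plane waves -/

section Cutoff

open scoped ContDiff

theorem deriv_eq_zero_of_notMem_Icc {h : ℝ → ℂ} {k l : ℝ} (h0 : ∀ t, t ∉ Icc k l → h t = 0)
    (t : ℝ) (ht : t ∉ Icc k l) : deriv h t = 0 := by
  have : h =ᶠ[𝓝 t] fun _ => 0 := by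
    filter_upwards [isClosed_Icc.isOpen_compl.mem_nhds ht] with s hs using h0 s hs
  rw [this.deriv_eq, deriv_const]

/-- Slowly varying cutoffs of the oscillating exponential `exp (i σ t)`. -/
theorem exists_slow_wave (σ : ℝ) : ∃ M : ℝ, ∀ k : ℝ, 1 ≤ k → ∃ h : ℝ → ℂ,
    ContDiff ℝ ∞ h ∧ (∀ t, t ∉ Icc k (2 * k) → h t = 0) ∧ (∀ t, ‖h t‖ ≤ M) ∧
    (∀ t, ‖deriv h t‖ ≤ M) ∧ (∀ t, ‖deriv (deriv h) t‖ ≤ M) ∧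
    (∀ t, ‖deriv h t - Complex.I * σ * h t‖ ≤ M / k) ∧
    ∀ t ∈ Icc (5 / 4 * k) (7 / 4 * k), ‖h t‖ = 1 := by
  -- Equal to `1` on `[5/4, 7/4]` and zero off `[1, 2]`; the cutoff used is `η(t/k)`.
  let η : ContDiffBump (3 / 2 : ℝ) := ⟨1 / 4, 1 / 2, by norm_num, by norm_num⟩
  have hη : ContDiff ℝ ∞ η := η.contDiff
  have hη1 : ContDiff ℝ ∞ (deriv η) := (contDiff_infty_iff_deriv.1 hη).2
  have hη2 : ContDiff ℝ ∞ (deriv (deriv η)) := (contDiff_infty_iff_deriv.1 hη1).2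
  have hc : HasCompactSupport η := η.hasCompactSupport
  obtain ⟨M0, hM0⟩ := hc.exists_bound_of_continuous hη.continuous
  obtain ⟨M1, hM1⟩ := hc.deriv.exists_bound_of_continuous hη1.continuous
  obtain ⟨M2, hM2⟩ := hc.deriv.deriv.exists_bound_of_continuous hη2.continuous
  have p0 := (norm_nonneg _).trans (hM0 0)
  have p1 := (norm_nonneg _).trans (hM1 0)
  have p2 := (norm_nonneg _).trans (hM2 0)
  have hs := abs_nonneg σ
  have q0 := mul_nonneg hs p0
  have q1 := mul_nonneg hs p1
  have q2 := mul_nonneg (sq_nonneg |σ|) p0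
  -- This dominates all the bounds below. It is uniform in `k` because each derivative of the cutoff
  -- brings a factor `k⁻¹ ≤ 1`.
  refine ⟨|σ| ^ 2 * M0 + 2 * |σ| * M1 + |σ| * M0 + M0 + M1 + M2, fun k hk => ?_⟩
  have hk0 : 0 < k := by linarith
  have hki : k⁻¹ ≤ 1 := inv_le_one_of_one_le₀ hk
  have hki0 : 0 < k⁻¹ := by positivity
  let e : ℝ → ℂ := fun t => Complex.exp (Complex.I * σ * t)
  have he : ∀ t, ‖e t‖ = 1 := by
    intro t
    have : Complex.I * σ * t = ((σ * t : ℝ) : ℂ) * Complex.I := by push_cast; ring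
    simp only [e]
    rw [this, Complex.norm_exp_ofReal_mul_I]
  have hed : ∀ t, HasDerivAt e (Complex.I * σ * e t) t := by
    intro t
    have h1 : HasDerivAt (fun t : ℝ => Complex.I * σ * (t : ℂ)) (Complex.I * σ * 1) t :=
      (Complex.ofRealCLM.hasDerivAt (x := t)).const_mul _
    convert! h1.cexp using 1
    simp only [e]
    ring
  have hres : ∀ {f : ℝ → ℝ}, ContDiff ℝ ∞ f → ∀ t,
      HasDerivAt (fun t : ℝ => ((f (t * k⁻¹) : ℝ) : ℂ)) (((deriv f (t * k⁻¹) * k⁻¹ : ℝ)) : ℂ) t := by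
    intro f hf t
    have h1 : HasDerivAt (fun t : ℝ => t * k⁻¹) k⁻¹ t := by
      simpa using (hasDerivAt_id t).mul_const k⁻¹
    have h2 := ((hf.differentiable (by simp)) (t * k⁻¹)).hasDerivAt.comp t h1
    exact h2.ofReal_comp
  let h : ℝ → ℂ := fun t => e t * (η (t * k⁻¹) : ℝ)
  have hd1 : ∀ t, HasDerivAt h
      (e t * (Complex.I * σ * (η (t * k⁻¹) : ℝ) + (k⁻¹ : ℝ) * (deriv η (t * k⁻¹) : ℝ))) t := by
    intro t
    convert! (hed t).mul (hres hη t) using 1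
    push_cast
    ring
  have hd1' : deriv h = fun t =>
      e t * (Complex.I * σ * (η (t * k⁻¹) : ℝ) + (k⁻¹ : ℝ) * (deriv η (t * k⁻¹) : ℝ)) :=
    funext fun t => (hd1 t).deriv
  have hd2 : ∀ t, HasDerivAt (deriv h)
      (e t * ((Complex.I * σ) ^ 2 * (η (t * k⁻¹) : ℝ) +
        2 * (Complex.I * σ) * (k⁻¹ : ℝ) * (deriv η (t * k⁻¹) : ℝ) +
        (k⁻¹ : ℝ) ^ 2 * (deriv (deriv η) (t * k⁻¹) : ℝ))) t := by
    intro t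
    rw [hd1']
    convert! (hed t).mul (((hres hη t).const_mul (Complex.I * σ)).add
      ((hres hη1 t).const_mul ((k⁻¹ : ℝ) : ℂ))) using 1
    simp only [Pi.add_apply]
    push_cast
    ring
  have nI : ‖Complex.I * (σ : ℂ)‖ = |σ| := by simp
  have b0 : ∀ t, ‖((η t : ℝ) : ℂ)‖ ≤ M0 := fun t => by simpa using hM0 t
  have b1 : ∀ t, ‖((deriv η t : ℝ) : ℂ)‖ ≤ M1 := fun t => by simpa using hM1 t
  have b2 : ∀ t, ‖((deriv (deriv η) t : ℝ) : ℂ)‖ ≤ M2 := fun t => by simpa using hM2 t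
  have nk : ‖((k⁻¹ : ℝ) : ℂ)‖ = k⁻¹ := by rw [Complex.norm_real, Real.norm_of_nonneg hki0.le]
  refine ⟨h, ?_, ?_, ?_, ?_, ?_, ?_, ?_⟩
  · have hec : ContDiff ℝ ∞ e :=
      (contDiff_const.mul Complex.ofRealCLM.contDiff).cexp
    exact hec.mul (Complex.ofRealCLM.contDiff.comp
      (hη.comp (contDiff_id.mul contDiff_const)))
  · intro t ht
    have : η (t * k⁻¹) = 0 := by
      refine η.zero_of_le_dist ?_
      by_contra! hcon
      rw [Real.dist_eq, abs_lt] at hcon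
      change -(1 / 2) < _ ∧ _ < 1 / 2 at hcon
      rw [← div_eq_mul_inv] at hcon
      have h1 : 1 < t / k := by linarith
      have h2 : t / k < 2 := by linarith
      rw [lt_div_iff₀ hk0] at h1
      rw [div_lt_iff₀ hk0] at h2
      exact ht ⟨by linarith, by linarith⟩
    simp only [h, this]
    simp
  · intro t
    rw [norm_mul, he, one_mul]
    refine (b0 _).trans ?_
    linarith
  · intro t
    rw [hd1', norm_mul, he, one_mul]
    calc _ ≤ |σ| * M0 + 1 * M1 := by
          refine (norm_add_le _ _).trans ?_
          rw [norm_mul _ (_ : ℂ), nI, norm_mul _ (_ : ℂ), nk]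
          gcongr
          · exact b0 _
          · exact b1 _
      _ ≤ _ := by
          linarith
  · intro t
    rw [(hd2 t).deriv, norm_mul, he, one_mul]
    have htri : ∀ c r x y z : ℂ, ‖c ^ 2 * x + 2 * c * r * y + r ^ 2 * z‖ ≤
        ‖c‖ ^ 2 * ‖x‖ + 2 * ‖c‖ * ‖r‖ * ‖y‖ + ‖r‖ ^ 2 * ‖z‖ := fun c r x y z =>
      norm_add₃_le.trans_eq (by simp only [norm_mul, norm_pow, Complex.norm_ofNat])
    calc _ ≤ |σ| ^ 2 * M0 + 2 * |σ| * 1 * M1 + 1 ^ 2 * M2 := by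
          refine (htri _ _ _ _ _).trans ?_
          rw [nI, nk]
          gcongr
          · exact b0 _
          · exact b1 _
          · exact b2 _
      _ ≤ _ := by linarith
  · intro t
    -- Only the derivative falling on the cutoff survives, and it costs `1/k`.
    have : deriv h t - Complex.I * σ * h t = e t * ((k⁻¹ : ℝ) * (deriv η (t * k⁻¹) : ℝ)) := by
      rw [hd1']; simp only [h]; ring
    rw [this, norm_mul, he, one_mul, norm_mul, nk, div_eq_inv_mul _ k]
    gcongr
    refine (b1 _).trans ?_
    linarith
  · intro t ht
    have : η (t * k⁻¹) = 1 := by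
      refine η.one_of_mem_closedBall ?_
      rw [Metric.mem_closedBall, Real.dist_eq, abs_le, ← div_eq_mul_inv]
      change -(1 / 4) ≤ _ ∧ _ ≤ 1 / 4
      have h1 : 5 / 4 ≤ t / k := by rw [le_div_iff₀ hk0]; exact ht.1
      have h2 : t / k ≤ 7 / 4 := by rw [div_le_iff₀ hk0]; exact ht.2
      constructor <;> linarith
    simp only [h, this]
    simp [he]

end Cutoff


/-! ### The trial functions and their membership in the initial domain -/

section Trial

open scoped ContDiff

/-- The exponent of the trial function: a gauge phase, transverse decay at rate `a y`, and the
phase of the inverted oscillator in `y`. The parameter `ε = ±1` selects the half-plane. -/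
def trialExponent (a κ : ℝ) (φ : ℝ × ℝ → ℝ) (ε : ℝ) (p : ℝ × ℝ) : ℂ :=
  Complex.I * φ p + (-(ε * a * p.1 * p.2) + Complex.I * κ * (p.2 ^ 2 - p.1 ^ 2) / 2)

/-- The amplitude of the trial function. -/
def trialAmplitude (b c : ℝ) (h : ℝ → ℂ) (ε : ℝ) (p : ℝ × ℝ) : ℂ :=
  logPull h 0 p.2 * (1 + ε * b * p.1 ^ 2) + c * logPull h 1 p.2 * p.1

/-- The derivative of `trialAmplitude` in `x`. -/
def trialAmplitudeX (b c : ℝ) (h : ℝ → ℂ) (ε : ℝ) (p : ℝ × ℝ) : ℂ :=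
  logPull h 0 p.2 * (2 * ε * b * p.1) + c * logPull h 1 p.2

/-- The derivative of `trialAmplitude` in `y`. -/
def trialAmplitudeY (b c : ℝ) (h : ℝ → ℂ) (ε : ℝ) (p : ℝ × ℝ) : ℂ :=
  logPull (deriv h) 1 p.2 * (1 + ε * b * p.1 ^ 2) +
    c * logPull (fun t => deriv h t - h t) 2 p.2 * p.1

/-- The second derivative of `trialAmplitude` in `y`. -/
def trialAmplitudeYY (b c : ℝ) (h : ℝ → ℂ) (ε : ℝ) (p : ℝ × ℝ) : ℂ :=
  logPull (fun t => deriv (deriv h) t - deriv h t) 2 p.2 * (1 + ε * b * p.1 ^ 2) +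
    c * logPull (fun t => deriv (deriv h) t - deriv h t - 2 * (deriv h t - h t)) 3 p.2 * p.1

/-- The `x`-derivative of `trialExponent` without the gauge phase. -/
def exponentX (a κ ε : ℝ) (p : ℝ × ℝ) : ℂ := -(ε * a * p.2) - Complex.I * κ * p.1

/-- The `y`-derivative of `trialExponent` without the gauge phase. -/
def exponentY (a κ ε : ℝ) (p : ℝ × ℝ) : ℂ := -(ε * a * p.1) + Complex.I * κ * p.2

/-- One half of the trial function. -/
def trialHalf (a κ b c : ℝ) (φ : ℝ × ℝ → ℝ) (h : ℝ → ℂ) (ε : ℝ) (p : ℝ × ℝ) : ℂ :=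
  Complex.exp (trialExponent a κ φ ε p) * trialAmplitude b c h ε p

/-- The trial function. -/
def trial (a κ b c : ℝ) (φ : ℝ × ℝ → ℝ) (h : ℝ → ℂ) (p : ℝ × ℝ) : ℂ :=
  if 0 ≤ p.1 then trialHalf a κ b c φ h 1 p else trialHalf a κ b c φ h (-1) p

/-- The amplitude of the image of `trialHalf` under the differential expression. -/
def actionAmplitude (a κ b c B w : ℝ) (h : ℝ → ℂ) (ε : ℝ) (p : ℝ × ℝ) : ℂ :=
  -(exponentX a κ ε p * (exponentX a κ ε p * trialAmplitude b c h ε p +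
      2 * trialAmplitudeX b c h ε p) + logPull h 0 p.2 * (2 * ε * b)) -
    (exponentY a κ ε p * (exponentY a κ ε p * trialAmplitude b c h ε p +
      2 * trialAmplitudeY b c h ε p) + trialAmplitudeYY b c h ε p) +
    2 * Complex.I * B * p.1 *
      (exponentY a κ ε p * trialAmplitude b c h ε p + trialAmplitudeY b c h ε p) +
    (B ^ 2 * p.1 ^ 2 + w ^ 2 * p.2 ^ 2) * trialAmplitude b c h ε p

variable {a κ b c B w : ℝ} {φ : ℝ × ℝ → ℝ} {A : ℝ × ℝ → ℝ × ℝ} {h : ℝ → ℂ}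

theorem hasDerivAt_ofReal (x : ℝ) : HasDerivAt (fun x : ℝ => (x : ℂ)) 1 x :=
  Complex.ofRealCLM.hasDerivAt

theorem hasDerivAt_trialExponent_x (hφ : ∀ p : ℝ × ℝ, HasDerivAt (fun x => φ (x, p.2)) (A p).1 p.1)
    (ε : ℝ) (p : ℝ × ℝ) :
    HasDerivAt (fun x => trialExponent a κ φ ε (x, p.2))
      (Complex.I * (A p).1 + exponentX a κ ε p) p.1 := by
  have hx := hasDerivAt_ofReal p.1
  have h1 := ((hφ p).ofReal_comp).const_mul Complex.I
  have h2 := ((hx.const_mul (ε * a : ℂ)).mul_const (p.2 : ℂ)).neg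
  have h3 := (((hx.pow 2).const_sub ((p.2 : ℂ) ^ 2)).const_mul (Complex.I * κ)).div_const 2
  convert! h1.add (h2.add h3) using 1
  rw [exponentX]
  push_cast
  ring

theorem hasDerivAt_trialExponent_y
    (hφ : ∀ p : ℝ × ℝ, HasDerivAt (fun y => φ (p.1, y)) ((A p).2 - B * p.1) p.2)
    (ε : ℝ) (p : ℝ × ℝ) :
    HasDerivAt (fun y => trialExponent a κ φ ε (p.1, y))
      (Complex.I * ((A p).2 - (B * p.1 : ℂ)) + exponentY a κ ε p) p.2 := by
  have hy := hasDerivAt_ofReal p.2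
  have h1 := ((hφ p).ofReal_comp).const_mul Complex.I
  have h2 := (hy.const_mul (ε * a * p.1 : ℂ)).neg
  have h3 := (((hy.pow 2).sub_const ((p.1 : ℂ) ^ 2)).const_mul (Complex.I * κ)).div_const 2
  convert! h1.add (h2.add h3) using 1
  rw [exponentY]
  push_cast
  ring

theorem hasDerivAt_exponentX (ε : ℝ) (p : ℝ × ℝ) :
    HasDerivAt (fun x => exponentX a κ ε (x, p.2)) (-(Complex.I * κ)) p.1 := by
  simpa [exponentX] using
    ((hasDerivAt_ofReal p.1).const_mul (Complex.I * κ)).const_sub (-(ε * a * p.2 : ℂ))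

theorem hasDerivAt_exponentY (ε : ℝ) (p : ℝ × ℝ) :
    HasDerivAt (fun y => exponentY a κ ε (p.1, y)) (Complex.I * κ) p.2 := by
  simpa [exponentY] using
    ((hasDerivAt_ofReal p.2).const_mul (Complex.I * κ)).const_add (-(ε * a * p.1 : ℂ))

theorem hasDerivAt_trialAmplitude_x (ε : ℝ) (p : ℝ × ℝ) :
    HasDerivAt (fun x => trialAmplitude b c h ε (x, p.2)) (trialAmplitudeX b c h ε p) p.1 := by
  have hx := hasDerivAt_ofReal p.1
  convert! ((((hx.pow 2).const_mul (ε * b : ℂ)).const_add 1).const_mul (logPull h 0 p.2)).add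
    (hx.const_mul (c * logPull h 1 p.2)) using 1
  rw [trialAmplitudeX]
  push_cast
  ring

theorem hasDerivAt_trialAmplitudeX (ε : ℝ) (p : ℝ × ℝ) :
    HasDerivAt (fun x => trialAmplitudeX b c h ε (x, p.2)) (logPull h 0 p.2 * (2 * ε * b)) p.1 := by
  have hx := hasDerivAt_ofReal p.1
  convert! ((hx.const_mul (2 * ε * b : ℂ)).const_mul (logPull h 0 p.2)).add_const
    (c * logPull h 1 p.2) using 1
  ring

theorem hasDerivAt_trialAmplitude_y (hh : ContDiff ℝ ∞ h) (h0 : ∀ t < 0, h t = 0)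
    (h1 : ∀ t < 0, deriv h t = 0) (ε : ℝ) (p : ℝ × ℝ) :
    HasDerivAt (fun y => trialAmplitude b c h ε (p.1, y)) (trialAmplitudeY b c h ε p) p.2 := by
  have hd : ∀ t, HasDerivAt h (deriv h t) t := fun t =>
    (hh.differentiable (by simp) t).hasDerivAt
  have e0 := hasDerivAt_logPull h0 h1 hd 0 p.2
  have e1 := hasDerivAt_logPull h0 h1 hd 1 p.2
  simp only [Nat.cast_zero, zero_mul, sub_zero, zero_add, Nat.cast_one, one_mul, Nat.reduceAdd] at e0 e1
  exact (e0.mul_const (1 + ε * b * p.1 ^ 2 : ℂ)).add ((e1.const_mul (c : ℂ)).mul_const (p.1 : ℂ))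

theorem hasDerivAt_trialAmplitudeY (hh : ContDiff ℝ ∞ h) (h0 : ∀ t < 0, h t = 0)
    (h1 : ∀ t < 0, deriv h t = 0) (h2 : ∀ t < 0, deriv (deriv h) t = 0) (ε : ℝ) (p : ℝ × ℝ) :
    HasDerivAt (fun y => trialAmplitudeY b c h ε (p.1, y)) (trialAmplitudeYY b c h ε p) p.2 := by
  have hd : ∀ t, HasDerivAt h (deriv h t) t := fun t =>
    (hh.differentiable (by simp) t).hasDerivAt
  have hd' : ∀ t, HasDerivAt (deriv h) (deriv (deriv h) t) t := fun t =>
    ((contDiff_infty_iff_deriv.1 hh).2.differentiable (by simp) t).hasDerivAt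
  have e0 := hasDerivAt_logPull h1 h2 hd' 1 p.2
  have e1 := hasDerivAt_logPull (h := fun t => deriv h t - h t)
    (h' := fun t => deriv (deriv h) t - deriv h t) (fun t ht => by simp [h0 t ht, h1 t ht])
    (fun t ht => by simp [h1 t ht, h2 t ht]) (fun t => (hd' t).sub (hd t)) 2 p.2
  simp only [Nat.cast_one, one_mul, Nat.cast_ofNat, Nat.reduceAdd] at e0 e1
  exact (e0.mul_const (1 + ε * b * p.1 ^ 2 : ℂ)).add ((e1.const_mul (c : ℂ)).mul_const (p.1 : ℂ))

theorem dx_trialHalf (hφ : ∀ p : ℝ × ℝ, HasDerivAt (fun x => φ (x, p.2)) (A p).1 p.1)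
    (ε : ℝ) (p : ℝ × ℝ) :
    dx (trialHalf a κ b c φ h ε) p = Complex.exp (trialExponent a κ φ ε p) *
      ((Complex.I * (A p).1 + exponentX a κ ε p) * trialAmplitude b c h ε p +
        trialAmplitudeX b c h ε p) :=
  (hasDerivAt_cexp_mul (hasDerivAt_trialExponent_x hφ ε p)
    (hasDerivAt_trialAmplitude_x ε p)).deriv

/-- After removal of the gauge phase the operator is `-∂x² - ∂y² + 2iBx∂y + B²x² + w²y²`. The second
derivatives `∓iκ` of the exponent cancel, so only its first derivatives occur in `actionAmplitude`.
-/
theorem hamiltonian_trialHalf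
    (hφx : ∀ p : ℝ × ℝ, HasDerivAt (fun x => φ (x, p.2)) (A p).1 p.1)
    (hφy : ∀ p : ℝ × ℝ, HasDerivAt (fun y => φ (p.1, y)) ((A p).2 - B * p.1) p.2)
    (hh : ContDiff ℝ ∞ h) (h0 : ∀ t < 0, h t = 0)
    (h1 : ∀ t < 0, deriv h t = 0) (h2 : ∀ t < 0, deriv (deriv h) t = 0) (ε : ℝ) (p : ℝ × ℝ) :
    hamiltonian A w (trialHalf a κ b c φ h ε) p =
      Complex.exp (trialExponent a κ φ ε p) * actionAmplitude a κ b c B w h ε p := by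
  have hX : magX A (trialHalf a κ b c φ h ε) = fun q => Complex.exp (trialExponent a κ φ ε q) *
      (Complex.I * (exponentX a κ ε q * trialAmplitude b c h ε q + trialAmplitudeX b c h ε q)) :=
    funext fun q => magX_cexp_mul (hasDerivAt_trialExponent_x hφx ε q)
      (hasDerivAt_trialAmplitude_x ε q)
  have hY : magY A (trialHalf a κ b c φ h ε) = fun q => Complex.exp (trialExponent a κ φ ε q) *
      (Complex.I * (exponentY a κ ε q * trialAmplitude b c h ε q + trialAmplitudeY b c h ε q) +
        B * q.1 * trialAmplitude b c h ε q) :=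
    funext fun q => magY_cexp_mul (hasDerivAt_trialExponent_y hφy ε q)
      (hasDerivAt_trialAmplitude_y hh h0 h1 ε q)
  have dX := (((hasDerivAt_exponentX (a := a) (κ := κ) ε p).mul
    (hasDerivAt_trialAmplitude_x (b := b) (c := c) (h := h) ε p)).add
    (hasDerivAt_trialAmplitudeX (b := b) (c := c) (h := h) ε p)).const_mul Complex.I
  have dQ := hasDerivAt_trialAmplitude_y (b := b) (c := c) hh h0 h1 ε p
  have dY := ((((hasDerivAt_exponentY (a := a) (κ := κ) ε p).mul dQ).add
    (hasDerivAt_trialAmplitudeY (b := b) (c := c) hh h0 h1 h2 ε p)).const_mul Complex.I).add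
      (dQ.const_mul (B * p.1 : ℂ))
  have hXX := magX_cexp_mul (Q := fun q => Complex.I * (exponentX a κ ε q *
    trialAmplitude b c h ε q + trialAmplitudeX b c h ε q)) (hasDerivAt_trialExponent_x
      (a := a) (κ := κ) hφx ε p) dX
  have hYY := magY_cexp_mul (Q := fun q => Complex.I * (exponentY a κ ε q *
    trialAmplitude b c h ε q + trialAmplitudeY b c h ε q) + B * q.1 * trialAmplitude b c h ε q)
    (hasDerivAt_trialExponent_y (a := a) (κ := κ) hφy ε p) dY
  rw [hamiltonian, hX, hY, hXX, hYY, trialHalf, actionAmplitude]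
  push_cast
  linear_combination Complex.exp (trialExponent a κ φ ε p) *
    (exponentX a κ ε p * (exponentX a κ ε p * trialAmplitude b c h ε p +
      2 * trialAmplitudeX b c h ε p) + logPull h 0 p.2 * (2 * ε * b) +
    exponentY a κ ε p * (exponentY a κ ε p * trialAmplitude b c h ε p +
      2 * trialAmplitudeY b c h ε p) + trialAmplitudeYY b c h ε p) * Complex.I_sq

theorem contDiff_trialHalf (hφ : ContDiff ℝ 2 φ) (hh : ContDiff ℝ ∞ h) (h0 : ∀ t < 0, h t = 0)
    (ε : ℝ) : ContDiff ℝ 2 (trialHalf a κ b c φ h ε) := by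
  have hh2 : ContDiff ℝ 2 h := by exact_mod_cast contDiff_infty.1 hh 2
  have l0 : ContDiff ℝ 2 fun p : ℝ × ℝ => logPull h 0 p.2 :=
    (contDiff_logPull h0 hh2 0).comp contDiff_snd
  have l1 : ContDiff ℝ 2 fun p : ℝ × ℝ => logPull h 1 p.2 :=
    (contDiff_logPull h0 hh2 1).comp contDiff_snd
  have x : ContDiff ℝ 2 fun p : ℝ × ℝ => (p.1 : ℂ) := Complex.ofRealCLM.contDiff.comp contDiff_fst
  have y : ContDiff ℝ 2 fun p : ℝ × ℝ => (p.2 : ℂ) := Complex.ofRealCLM.contDiff.comp contDiff_snd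
  have f : ContDiff ℝ 2 fun p : ℝ × ℝ => (φ p : ℂ) := Complex.ofRealCLM.contDiff.comp hφ
  unfold trialHalf trialExponent trialAmplitude
  fun_prop

theorem continuous_dx_trialHalf
    (hφ : ContDiff ℝ 2 φ) (hφx : ∀ p : ℝ × ℝ, HasDerivAt (fun x => φ (x, p.2)) (A p).1 p.1)
    (hA : Continuous A)
    (hh : ContDiff ℝ ∞ h) (h0 : ∀ t < 0, h t = 0) (ε : ℝ) :
    Continuous (dx (trialHalf a κ b c φ h ε)) := by
  rw [funext (dx_trialHalf hφx ε)]
  have l0 : Continuous (logPull h 0) := (contDiff_logPull h0 hh 0).continuous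
  have l1 : Continuous (logPull h 1) := (contDiff_logPull h0 hh 1).continuous
  have f := hφ.continuous
  unfold trialExponent exponentX trialAmplitude trialAmplitudeX
  fun_prop

theorem continuous_actionAmplitude (hh : ContDiff ℝ ∞ h) (h0 : ∀ t < 0, h t = 0)
    (h1 : ∀ t < 0, deriv h t = 0) (h2 : ∀ t < 0, deriv (deriv h) t = 0) (ε : ℝ) :
    Continuous (actionAmplitude a κ b c B w h ε) := by
  have c1 : ContDiff ℝ ∞ (deriv h) := (contDiff_infty_iff_deriv.1 hh).2
  have c2 : ContDiff ℝ ∞ (deriv (deriv h)) := (contDiff_infty_iff_deriv.1 c1).2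
  have l0 : Continuous (logPull h 0) := (contDiff_logPull h0 hh 0).continuous
  have l1 : Continuous (logPull h 1) := (contDiff_logPull h0 hh 1).continuous
  have l2 : Continuous (logPull (deriv h) 1) := (contDiff_logPull h1 c1 1).continuous
  have l3 : Continuous (logPull (fun t => deriv h t - h t) 2) :=
    (contDiff_logPull (fun t ht => by simp [h0 t ht, h1 t ht]) (c1.sub hh) 2).continuous
  have l4 : Continuous (logPull (fun t => deriv (deriv h) t - deriv h t) 2) :=
    (contDiff_logPull (fun t ht => by simp [h1 t ht, h2 t ht]) (c2.sub c1) 2).continuous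
  have l5 : Continuous (logPull (fun t => deriv (deriv h) t - deriv h t -
      2 * (deriv h t - h t)) 3) :=
    (contDiff_logPull (fun t ht => by simp [h0 t ht, h1 t ht, h2 t ht])
      ((c2.sub c1).sub (contDiff_const.mul (c1.sub hh))) 3).continuous
  unfold actionAmplitude exponentX exponentY trialAmplitude trialAmplitudeX trialAmplitudeY
    trialAmplitudeYY
  fun_prop

theorem trial_eventuallyEq_of_pos {p : ℝ × ℝ} (hp : 0 < p.1) :
    trial a κ b c φ h =ᶠ[𝓝 p] trialHalf a κ b c φ h 1 := by
  filter_upwards [(isOpen_lt continuous_const continuous_fst).mem_nhds hp] with q hq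
  exact if_pos (le_of_lt hq)

theorem trial_eventuallyEq_of_neg {p : ℝ × ℝ} (hp : p.1 < 0) :
    trial a κ b c φ h =ᶠ[𝓝 p] trialHalf a κ b c φ h (-1) := by
  filter_upwards [(isOpen_lt continuous_fst continuous_const).mem_nhds hp] with q hq
  exact if_neg (not_le.2 hq)

theorem exists_sign_trial_eventuallyEq {p : ℝ × ℝ} (hp : p.1 ≠ 0) :
    ∃ ε : ℝ, (ε = 1 ∨ ε = -1) ∧ ε * p.1 = |p.1| ∧
      trial a κ b c φ h =ᶠ[𝓝 p] trialHalf a κ b c φ h ε := by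
  rcases hp.lt_or_gt with hp | hp
  · exact ⟨-1, Or.inr rfl, by rw [abs_of_neg hp]; ring, trial_eventuallyEq_of_neg hp⟩
  · exact ⟨1, Or.inl rfl, by rw [abs_of_pos hp]; ring, trial_eventuallyEq_of_pos hp⟩

theorem trialHalf_of_fst_eq_zero (ε : ℝ) (y : ℝ) :
    trialHalf a κ b c φ h ε (0, y) = trialHalf a κ b c φ h 1 (0, y) := by
  simp [trialHalf, trialExponent, trialAmplitude]

theorem continuous_trial (hφ : ContDiff ℝ 2 φ) (hh : ContDiff ℝ ∞ h) (h0 : ∀ t < 0, h t = 0) :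
    Continuous (trial a κ b c φ h) := by
  refine Continuous.if_le (contDiff_trialHalf hφ hh h0 1).continuous
    (contDiff_trialHalf hφ hh h0 (-1)).continuous continuous_const continuous_fst ?_
  rintro ⟨x, y⟩ hx
  obtain rfl : 0 = x := hx
  exact (trialHalf_of_fst_eq_zero (-1) y).symm

theorem ae_fst_ne_zero : ∀ᵐ p : ℝ × ℝ, p.1 ≠ 0 :=
  Measure.quasiMeasurePreserving_fst.ae (Measure.ae_ne volume 0)

/-- On the line `x = 0` only the term `-εay` of the `x`-derivative differs between the two sides:
`εbx²` has zero slope there and the `c` term is the same function of `p` for both signs. The jump is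
therefore `-2ay` times the value. -/
theorem memD0_trial (hφ : ContDiff ℝ 2 φ)
    (hφx : ∀ p : ℝ × ℝ, HasDerivAt (fun x => φ (x, p.2)) (A p).1 p.1)
    (hA : Continuous A)
    (hh : ContDiff ℝ ∞ h) (h0 : ∀ t < 0, h t = 0)
    (hL : MemLp (trial a κ b c φ h) 2 volume)
    (hL' : MemLp (hamiltonian A w (trial a κ b c φ h)) 2 volume) :
    MemD0 A w (-2 * a) (trial a κ b c φ h) where
  continuous := continuous_trial hφ hh h0
  contDiffOn := by
    intro p hp
    obtain ⟨ε, -, -, he⟩ := exists_sign_trial_eventuallyEq (a := a) (κ := κ) (b := b) (c := c)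
      (φ := φ) (h := h) (p := p) hp
    exact ((contDiff_trialHalf hφ hh h0 ε).contDiffAt.congr_of_eventuallyEq he).contDiffWithinAt
  matching := by
    intro y
    refine ⟨dx (trialHalf a κ b c φ h 1) (0, y), dx (trialHalf a κ b c φ h (-1)) (0, y), ?_, ?_, ?_⟩
    · refine ((continuous_dx_trialHalf hφ hφx hA hh h0 1).tendsto (0, y)).mono_left
        nhdsWithin_le_nhds |>.congr' ?_
      filter_upwards [self_mem_nhdsWithin] with q hq
      exact (dx_congr (trial_eventuallyEq_of_pos hq)).eq_of_nhds.symm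
    · refine ((continuous_dx_trialHalf hφ hφx hA hh h0 (-1)).tendsto (0, y)).mono_left
        nhdsWithin_le_nhds |>.congr' ?_
      filter_upwards [self_mem_nhdsWithin] with q hq
      exact (dx_congr (trial_eventuallyEq_of_neg hq)).eq_of_nhds.symm
    · rw [dx_trialHalf hφx, dx_trialHalf hφx]
      simp [trial, trialHalf, trialExponent, trialAmplitude, exponentX, trialAmplitudeX]
      ring
  memLp := hL
  memLp_hamiltonian := hL'

end Trial

/-! ### The residual equation and polynomial bounds in `s = xy` -/

section Residual

open scoped ContDiff

/-- The part of the residual that is damped by `1 / y ^ 2`, in terms of `s = x y`, `u = 1 / y`. -/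
def remainder (a κ b c B w μ ε : ℝ) (s u h0 h1 h2 : ℂ) : ℂ :=
  h0 * (-2 * B * κ * s * (ε * b * s ^ 2 + c * s) +
      2 * Complex.I * κ * s * (2 * ε * b * s + c)) -
    (h2 - h1) * (1 + ε * b * s ^ 2 * u ^ 2) - c * (h2 - 3 * h1 + 2 * h0) * s * u ^ 2 -
    2 * Complex.I * κ * (h1 * ε * b * s ^ 2 + c * (h1 - h0) * s) +
    (2 * ε * a + 2 * Complex.I * B) * s *
      (h1 * (1 + ε * b * s ^ 2 * u ^ 2) + c * (h1 - h0) * u ^ 2 * s) +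
    s ^ 2 * (B ^ 2 - w ^ 2 - 2 * Complex.I * ε * a * B) * h0 *
      (1 + u ^ 2 * (ε * b * s ^ 2 + c * s)) -
    μ * h0 * (ε * b * s ^ 2 + c * s)

variable {a κ b c B w : ℝ} {h : ℝ → ℂ}

theorem trialAmplitude_eq (ε : ℝ) (p : ℝ × ℝ) (hp : 0 < p.2) :
    trialAmplitude b c h ε p = h (Real.log p.2) *
      (1 + (p.2⁻¹ : ℝ) ^ 2 * (ε * b * (p.1 * p.2 : ℝ) ^ 2 + c * (p.1 * p.2 : ℝ))) := by
  have hy : (p.2 : ℂ) ≠ 0 := by exact_mod_cast hp.ne'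
  rw [trialAmplitude, logPull_of_pos _ _ hp, logPull_of_pos _ _ hp]
  push_cast
  field_simp
  ring

/-- Each hypothesis removes one term that does not decay at fixed `s`: `hκ` the growing `y²` term,
`hb` the magnetic term `-2Bκs` against `4abs` from the `b` correction, and `hc` the constant `-2εb`
against `2εac`. -/
theorem actionAmplitude_sub (hκ : κ ^ 2 = a ^ 2 - w ^ 2) (hb : 2 * a * b = B * κ) (hc : a * c = b)
    (μ : ℝ) {ε : ℝ} (hε : ε = 1 ∨ ε = -1) (p : ℝ × ℝ) (hp : 0 < p.2) :
    actionAmplitude a κ b c B w h ε p - μ * trialAmplitude b c h ε p =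
      -(2 * Complex.I * κ) * deriv h (Real.log p.2) - μ * h (Real.log p.2) +
      (p.2⁻¹ : ℝ) ^ 2 * remainder a κ b c B w μ ε (p.1 * p.2 : ℝ) (p.2⁻¹ : ℝ) (h (Real.log p.2))
        (deriv h (Real.log p.2)) (deriv (deriv h) (Real.log p.2)) := by
  have hy : (p.2 : ℂ) ≠ 0 := by exact_mod_cast hp.ne'
  have hκ' : (κ : ℂ) ^ 2 = a ^ 2 - w ^ 2 := by exact_mod_cast hκ
  have hb' : 2 * (a : ℂ) * b = B * κ := by exact_mod_cast hb
  have hc' : (a : ℂ) * c = b := by exact_mod_cast hc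
  have hε' : (ε : ℂ) ^ 2 = 1 := by rcases hε with rfl | rfl <;> norm_num
  have hx : (p.1 : ℂ) = (p.1 * p.2 : ℝ) * (p.2⁻¹ : ℝ) := by
    push_cast; field_simp
  have hu : ((p.2⁻¹ : ℝ) : ℂ) * p.2 = 1 := by push_cast; field_simp
  rw [actionAmplitude, exponentX, exponentY, trialAmplitude, trialAmplitudeX, trialAmplitudeY,
    trialAmplitudeYY]
  simp only [logPull_of_pos _ _ hp, div_eq_mul_inv, ← inv_pow, ← Complex.ofReal_inv]
  generalize h (Real.log p.2) = h0
  generalize deriv (deriv h) (Real.log p.2) = h2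
  generalize deriv h (Real.log p.2) = h1
  generalize ((p.1 * p.2 : ℝ) : ℂ) = s at *
  generalize ((p.2⁻¹ : ℝ) : ℂ) = u at *
  generalize (p.2 : ℂ) = y at *
  rw [hx, remainder]
  generalize (ε : ℂ) = e at *
  -- After the substitution `x = su`, everything is polynomial in `s`, `u`, `y` and the values of
  -- `h` and its derivatives, subject to `uy = 1`, `ε² = 1` and the three relations for `κ`, `b`,
  -- `c`.
  linear_combination
    ((-κ ^ 2 * ((s * u) ^ 2 + y ^ 2) + 2 * B * κ * (s * u) * y) *
      (h0 * (1 + u ^ 2 * (e * b * s ^ 2 + c * s)))) * Complex.I_sq +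
    (((s * u) ^ 2 + y ^ 2) * (h0 * (1 + u ^ 2 * (e * b * s ^ 2 + c * s)))) * hκ' +
    (2 * h0 * s) * hb' + (2 * e * h0) * hc' +
    (2 * e * a * h0 * (2 * e * b * s + c) -
      2 * Complex.I * κ * (h1 * (1 + e * b * s ^ 2 * u ^ 2) + c * (h1 - h0) * s * u ^ 2) -
      2 * B * κ * s * (h0 * (1 + u ^ 2 * (e * b * s ^ 2 + c * s)))) * hu +
    (-(a ^ 2 * ((s * u) ^ 2 + y ^ 2) * (h0 * (1 + u ^ 2 * (e * b * s ^ 2 + c * s)))) +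
      4 * a * b * s * h0) * hε'

theorem hasTemperateGrowth_remainder {E : Type*} [NormedAddCommGroup E] [NormedSpace ℝ E]
    (a κ b c B w μ ε : ℝ) {s u h0 h1 h2 : E → ℂ} (hs : s.HasTemperateGrowth)
    (hu : u.HasTemperateGrowth) (hh0 : h0.HasTemperateGrowth) (hh1 : h1.HasTemperateGrowth)
    (hh2 : h2.HasTemperateGrowth) : Function.HasTemperateGrowth
      fun z => remainder a κ b c B w μ ε (s z) (u z) (h0 z) (h1 z) (h2 z) := by
  unfold remainder
  fun_prop

/-- With the other variables bounded, temperate growth of order zero is a polynomial bound in `|s|`,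
which `xⁿ/n! ≤ exp x` absorbs into any exponential. This avoids counting degrees in `remainder`. -/
theorem exists_exp_bound {f : ℝ × ℝ × ℂ × ℂ × ℂ → ℂ} (hf : f.HasTemperateGrowth) (M : ℝ)
    {δ : ℝ} (hδ : 0 < δ) : ∃ C, 0 ≤ C ∧ ∀ (s u : ℝ) (h0 h1 h2 : ℂ), |u| ≤ 1 → ‖h0‖ ≤ M →
      ‖h1‖ ≤ M → ‖h2‖ ≤ M → ‖f (s, u, h0, h1, h2)‖ ≤ C * Real.exp (δ * |s|) := by
  obtain ⟨n, C, hC⟩ := hf.2 0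
  simp only [norm_iteratedFDeriv_zero] at hC
  have hC0 : 0 ≤ C := by
    have := (norm_nonneg _).trans (hC 0)
    simpa using this
  refine ⟨C * (n.factorial * δ⁻¹ ^ n * Real.exp (δ * (2 + |M|))), by positivity,
    fun s u h0 h1 h2 hu hh0 hh1 hh2 => (hC _).trans ?_⟩
  have hM := le_abs_self M
  have hX : 1 + ‖(s, u, h0, h1, h2)‖ ≤ |s| + (2 + |M|) := by
    have : ‖(s, u, h0, h1, h2)‖ ≤ |s| + (1 + |M|) := by
      simp only [Prod.norm_mk, Real.norm_eq_abs]
      have := abs_nonneg s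
      have := abs_nonneg M
      refine max_le (by linarith) (max_le (by linarith) (max_le (by linarith)
        (max_le (by linarith) (by linarith))))
    linarith
  have h0X : 0 ≤ |s| + (2 + |M|) := by positivity
  have key := Real.pow_div_factorial_le_exp (δ * (|s| + (2 + |M|))) (by positivity) n
  rw [div_le_iff₀ (by positivity), mul_pow, mul_add, Real.exp_add] at key
  rw [mul_assoc C]
  gcongr
  calc (1 + ‖(s, u, h0, h1, h2)‖) ^ n ≤ (|s| + (2 + |M|)) ^ n := by gcongr
    _ = δ⁻¹ ^ n * (δ ^ n * (|s| + (2 + |M|)) ^ n) := by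
        rw [← mul_assoc, ← mul_pow, inv_mul_cancel₀ hδ.ne', one_pow, one_mul]
    _ ≤ δ⁻¹ ^ n * (Real.exp (δ * |s|) * Real.exp (δ * (2 + |M|)) * n.factorial) := by gcongr
    _ = _ := by ring

theorem exists_remainder_bound (a κ b c B w μ M : ℝ) {δ : ℝ} (hδ : 0 < δ) :
    ∃ C, 0 ≤ C ∧ ∀ ε : ℝ, (ε = 1 ∨ ε = -1) → ∀ (s u : ℝ) (h0 h1 h2 : ℂ), |u| ≤ 1 → ‖h0‖ ≤ M →
      ‖h1‖ ≤ M → ‖h2‖ ≤ M →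
      ‖remainder a κ b c B w μ ε s u h0 h1 h2‖ ≤ C * Real.exp (δ * |s|) ∧
      ‖h0 * (1 + (u : ℂ) ^ 2 * (ε * b * (s : ℂ) ^ 2 + c * s))‖ ≤ C * Real.exp (δ * |s|) := by
  let E := ℝ × ℝ × ℂ × ℂ × ℂ
  have hs : Function.HasTemperateGrowth fun z : E => (z.1 : ℂ) :=
    (Complex.ofRealCLM ∘L ContinuousLinearMap.fst ℝ ℝ (ℝ × ℂ × ℂ × ℂ)).hasTemperateGrowth
  have hu : Function.HasTemperateGrowth fun z : E => (z.2.1 : ℂ) :=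
    (Complex.ofRealCLM ∘L ContinuousLinearMap.fst ℝ _ _ ∘L
      ContinuousLinearMap.snd ℝ ℝ (ℝ × ℂ × ℂ × ℂ)).hasTemperateGrowth
  have hh0 : Function.HasTemperateGrowth fun z : E => z.2.2.1 :=
    (ContinuousLinearMap.fst ℝ _ _ ∘L ContinuousLinearMap.snd ℝ _ _ ∘L
      ContinuousLinearMap.snd ℝ ℝ (ℝ × ℂ × ℂ × ℂ)).hasTemperateGrowth
  have hh1 : Function.HasTemperateGrowth fun z : E => z.2.2.2.1 :=
    (ContinuousLinearMap.fst ℝ _ _ ∘L ContinuousLinearMap.snd ℝ _ _ ∘L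
      ContinuousLinearMap.snd ℝ _ _ ∘L
      ContinuousLinearMap.snd ℝ ℝ (ℝ × ℂ × ℂ × ℂ)).hasTemperateGrowth
  have hh2 : Function.HasTemperateGrowth fun z : E => z.2.2.2.2 :=
    (ContinuousLinearMap.snd ℝ _ _ ∘L ContinuousLinearMap.snd ℝ _ _ ∘L
      ContinuousLinearMap.snd ℝ _ _ ∘L
      ContinuousLinearMap.snd ℝ ℝ (ℝ × ℂ × ℂ × ℂ)).hasTemperateGrowth
  have hamp : ∀ {s u h0 : E → ℂ} (ε : ℝ), s.HasTemperateGrowth → u.HasTemperateGrowth →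
      h0.HasTemperateGrowth → Function.HasTemperateGrowth
        fun z => h0 z * (1 + (u z) ^ 2 * (ε * b * (s z) ^ 2 + c * s z)) := by
    intro s u h0 ε hs hu hh0
    fun_prop
  obtain ⟨C1, p1, hC1⟩ := exists_exp_bound
    (hasTemperateGrowth_remainder a κ b c B w μ 1 hs hu hh0 hh1 hh2) M hδ
  obtain ⟨C2, p2, hC2⟩ := exists_exp_bound
    (hasTemperateGrowth_remainder a κ b c B w μ (-1) hs hu hh0 hh1 hh2) M hδ
  obtain ⟨C3, p3, hC3⟩ := exists_exp_bound (hamp 1 hs hu hh0) M hδ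
  obtain ⟨C4, p4, hC4⟩ := exists_exp_bound (hamp (-1) hs hu hh0) M hδ
  refine ⟨C1 + C2 + C3 + C4, by positivity, fun ε hε s u h0 h1 h2 i1 i2 i3 i4 => ?_⟩
  have e := Real.exp_pos (δ * |s|)
  have q1 := mul_nonneg p1 e.le
  have q2 := mul_nonneg p2 e.le
  have q3 := mul_nonneg p3 e.le
  have q4 := mul_nonneg p4 e.le
  have r1 := hC1 s u h0 h1 h2 i1 i2 i3 i4
  have r2 := hC2 s u h0 h1 h2 i1 i2 i3 i4
  have r3 := hC3 s u h0 h1 h2 i1 i2 i3 i4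
  have r4 := hC4 s u h0 h1 h2 i1 i2 i3 i4
  simp only [add_mul]
  rcases hε with rfl | rfl
  · exact ⟨r1.trans (by linarith), r3.trans (by linarith)⟩
  · exact ⟨r2.trans (by linarith), r4.trans (by linarith)⟩

end Residual


/-! ### Norm estimates in logarithmic strips -/

section Integrals

theorem lintegral_exp_neg_mul_abs {r : ℝ} (hr : 0 < r) :
    ∫⁻ x : ℝ, ENNReal.ofReal (Real.exp (-(r * |x|))) = ENNReal.ofReal (2 / r) := by
  have hI : ∫ x in Ioi (0 : ℝ), Real.exp (-(r * x)) = 1 / r := by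
    have := integral_exp_mul_Ioi (neg_lt_zero.2 hr) 0
    simp only [neg_mul] at this
    rw [this]
    simp
  have hint : Integrable fun x : ℝ => Real.exp (-(r * |x|)) := by
    -- The integral of a nonintegrable function is zero by convention, so a nonzero value proves
    -- integrability.
    refine Integrable.of_integral_ne_zero ?_
    rw [integral_comp_abs (f := fun x => Real.exp (-(r * x))), hI]
    positivity
  rw [← ofReal_integral_eq_lintegral_ofReal hint (ae_of_all _ fun x => (Real.exp_pos _).le),
    integral_comp_abs (f := fun x => Real.exp (-(r * x))), hI]
  congr 1
  ring

theorem setLIntegral_div_Icc_exp {C l r : ℝ} (hC : 0 ≤ C) (hlr : l ≤ r) :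
    ∫⁻ y in Icc (Real.exp l) (Real.exp r), ENNReal.ofReal (C / y) =
      ENNReal.ofReal (C * (r - l)) := by
  have hle : Real.exp l ≤ Real.exp r := Real.exp_le_exp.2 hlr
  have hpos := Real.exp_pos l
  have hcont : ContinuousOn (fun y : ℝ => C / y) (Icc (Real.exp l) (Real.exp r)) :=
    continuousOn_const.div continuousOn_id fun y hy => (hpos.trans_le hy.1).ne'
  rw [← ofReal_integral_eq_lintegral_ofReal hcont.integrableOn_Icc, integral_Icc_eq_integral_Ioc,
    ← intervalIntegral.integral_of_le hle]
  · simp only [div_eq_mul_inv]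
    rw [intervalIntegral.integral_const_mul, integral_inv_of_pos hpos (Real.exp_pos r),
      ← Real.exp_sub, Real.log_exp]
  · filter_upwards [ae_restrict_mem measurableSet_Icc] with y hy
    exact div_nonneg hC (hpos.trans_le hy.1).le

/-- The square of the profile `exp (-δ |x| y / 2)` cut off to a logarithmic strip. -/
def stripWeight (δ k : ℝ) (p : ℝ × ℝ) : ℝ :=
  (Icc (Real.exp k) (Real.exp (2 * k))).indicator (fun y => Real.exp (-(δ * |p.1| * y))) p.2

theorem measurable_stripWeight (δ k : ℝ) : Measurable (stripWeight δ k) := by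
  have : stripWeight δ k = (Prod.snd ⁻¹' Icc (Real.exp k) (Real.exp (2 * k))).indicator
      fun p : ℝ × ℝ => Real.exp (-(δ * |p.1| * p.2)) := by
    ext p
    simp only [stripWeight, indicator, mem_preimage]
  rw [this]
  exact Measurable.indicator (by fun_prop) (measurable_snd measurableSet_Icc)

/-- The `x`-integral is `2/(δy)`, and `dy/y` gives `[eᵏ, e²ᵏ]` the mass `k`. -/
theorem lintegral_stripWeight {δ k : ℝ} (hδ : 0 < δ) (hk : 0 ≤ k) :
    ∫⁻ p : ℝ × ℝ, ENNReal.ofReal (stripWeight δ k p) = ENNReal.ofReal (2 / δ * k) := by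
  rw [Measure.volume_eq_prod, lintegral_prod_symm _
    (measurable_stripWeight δ k).ennreal_ofReal.aemeasurable]
  have hin : ∀ y : ℝ, ∫⁻ x : ℝ, ENNReal.ofReal (stripWeight δ k (x, y)) =
      (Icc (Real.exp k) (Real.exp (2 * k))).indicator
        (fun y => ENNReal.ofReal (2 / δ / y)) y := by
    intro y
    by_cases hy : y ∈ Icc (Real.exp k) (Real.exp (2 * k))
    · have hy0 : 0 < y := (Real.exp_pos k).trans_le hy.1
      simp only [stripWeight, indicator_of_mem hy]
      have := lintegral_exp_neg_mul_abs (mul_pos hδ hy0)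
      rw [div_div, ← this]
      refine lintegral_congr fun x => ?_
      congr 3
      ring
    · simp only [stripWeight, indicator_of_notMem hy, ENNReal.ofReal_zero, lintegral_zero]
  simp_rw [hin]
  rw [lintegral_indicator measurableSet_Icc, setLIntegral_div_Icc_exp (by positivity) (by linarith)]
  congr 1
  ring

/-- The region under the hyperbola `|x| y = 1` over a logarithmic interval. -/
def hyperbolicStrip (l r : ℝ) : Set (ℝ × ℝ) :=
  {p | p.2 ∈ Icc (Real.exp l) (Real.exp r) ∧ |p.1| * p.2 ≤ 1}

theorem measurableSet_hyperbolicStrip (l r : ℝ) : MeasurableSet (hyperbolicStrip l r) :=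
  (measurable_snd measurableSet_Icc).inter
    (measurableSet_le (by fun_prop : Measurable fun p : ℝ × ℝ => |p.1| * p.2) measurable_const)

theorem volume_hyperbolicStrip {l r : ℝ} (hlr : l ≤ r) :
    volume (hyperbolicStrip l r) = ENNReal.ofReal (2 * (r - l)) := by
  rw [Measure.volume_eq_prod, Measure.prod_apply_symm (measurableSet_hyperbolicStrip l r),
    ← setLIntegral_div_Icc_exp zero_le_two hlr, ← lintegral_indicator measurableSet_Icc]
  refine lintegral_congr fun y => ?_
  by_cases hy : y ∈ Icc (Real.exp l) (Real.exp r)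
  · have hy0 : 0 < y := (Real.exp_pos l).trans_le hy.1
    have : (fun x => (x, y)) ⁻¹' hyperbolicStrip l r = Icc (-(1 / y)) (1 / y) := by
      ext x
      simp only [hyperbolicStrip, mem_preimage, mem_ofPred_eq, hy, true_and]
      rw [← le_div_iff₀ hy0, abs_le, mem_Icc]
    rw [this, indicator_of_mem hy, Real.volume_Icc]
    congr 1
    ring
  · have : (fun x => (x, y)) ⁻¹' hyperbolicStrip l r = ∅ :=
      eq_empty_of_forall_notMem fun x hx => hy hx.1
    rw [this, indicator_of_notMem hy, measure_empty]

theorem eLpNorm_two_sq {f : ℝ × ℝ → ℂ} :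
    eLpNorm f 2 volume ^ 2 = ∫⁻ p, ‖f p‖ₑ ^ 2 := by
  have := eLpNorm_nnreal_pow_eq_lintegral (f := f) (μ := (volume : Measure (ℝ × ℝ)))
    (p := 2) two_ne_zero
  simpa using this

theorem eLpNorm_sq_le_of_stripWeight {f : ℝ × ℝ → ℂ} {δ k C : ℝ} (hδ : 0 < δ) (hk : 0 ≤ k)
    (hf : ∀ᵐ p, ‖f p‖ ^ 2 ≤ C * stripWeight δ k p) (hC : 0 ≤ C) :
    eLpNorm f 2 volume ^ 2 ≤ ENNReal.ofReal (C * (2 / δ * k)) := by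
  rw [eLpNorm_two_sq, ENNReal.ofReal_mul hC, ← lintegral_stripWeight hδ hk,
    ← lintegral_const_mul' _ _ ENNReal.ofReal_ne_top]
  refine lintegral_mono_ae ?_
  filter_upwards [hf] with p hp
  rw [← ENNReal.ofReal_mul hC, ← ofReal_norm, ← ENNReal.ofReal_pow (norm_nonneg _)]
  exact ENNReal.ofReal_le_ofReal hp

theorem memLp_of_stripWeight {f : ℝ × ℝ → ℂ} {δ k C : ℝ} (hδ : 0 < δ) (hk : 0 ≤ k)
    (hm : AEStronglyMeasurable f volume)
    (hf : ∀ᵐ p, ‖f p‖ ^ 2 ≤ C * stripWeight δ k p) (hC : 0 ≤ C) : MemLp f 2 volume := by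
  refine ⟨hm, ?_⟩
  have := (eLpNorm_sq_le_of_stripWeight hδ hk hf hC).trans_lt ENNReal.ofReal_lt_top
  exact (ENNReal.pow_lt_top_iff.1 this).resolve_right two_ne_zero

theorem norm_toLp_sq_le_of_stripWeight {f : ℝ × ℝ → ℂ} {δ k C : ℝ} (hδ : 0 < δ) (hk : 0 ≤ k)
    (hL : MemLp f 2 volume)
    (hf : ∀ᵐ p, ‖f p‖ ^ 2 ≤ C * stripWeight δ k p) (hC : 0 ≤ C) :
    ‖hL.toLp f‖ ^ 2 ≤ C * (2 / δ * k) := by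
  have := ENNReal.toReal_mono ENNReal.ofReal_ne_top (eLpNorm_sq_le_of_stripWeight hδ hk hf hC)
  rwa [ENNReal.toReal_pow, ENNReal.toReal_ofReal (by positivity), ← Lp.norm_toLp f hL] at this

theorem le_norm_toLp_sq {f : ℝ × ℝ → ℂ} {l r m : ℝ} (hlr : l ≤ r) (hm : 0 ≤ m)
    (hL : MemLp f 2 volume) (hf : ∀ᵐ p, p ∈ hyperbolicStrip l r → m ≤ ‖f p‖ ^ 2) :
    m * (2 * (r - l)) ≤ ‖hL.toLp f‖ ^ 2 := by
  have h1 : ENNReal.ofReal (m * (2 * (r - l))) ≤ eLpNorm f 2 volume ^ 2 := by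
    rw [eLpNorm_two_sq, ENNReal.ofReal_mul hm, ← volume_hyperbolicStrip hlr,
      ← setLIntegral_const]
    refine le_trans ?_ (setLIntegral_le_lintegral (hyperbolicStrip l r) _)
    refine setLIntegral_mono_ae' (measurableSet_hyperbolicStrip l r) ?_
    filter_upwards [hf] with p hp hpm
    rw [← ofReal_norm, ← ENNReal.ofReal_pow (norm_nonneg _)]
    exact ENNReal.ofReal_le_ofReal (hp hpm)
  have h2 := ENNReal.toReal_mono (ENNReal.pow_ne_top hL.2.ne) h1
  rwa [ENNReal.toReal_pow, ← Lp.norm_toLp f hL, ENNReal.toReal_ofReal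
    (mul_nonneg hm (by linarith))] at h2

end Integrals

/-! ### Weyl sequences at every real energy -/

section Weyl

open scoped ContDiff

variable {a κ b c B w : ℝ} {φ : ℝ × ℝ → ℝ} {A : ℝ × ℝ → ℝ × ℝ} {h : ℝ → ℂ}

theorem norm_cexp_trialExponent {ε : ℝ} {p : ℝ × ℝ} (hε : ε * p.1 = |p.1|) :
    ‖Complex.exp (trialExponent a κ φ ε p)‖ = Real.exp (-(a * (|p.1| * p.2))) := by
  rw [Complex.norm_exp, ← hε]
  congr 1
  have : trialExponent a κ φ ε p = ((-(a * (ε * p.1 * p.2)) : ℝ) : ℂ) +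
      ((φ p + κ * (p.2 ^ 2 - p.1 ^ 2) / 2 : ℝ) : ℂ) * Complex.I := by
    rw [trialExponent]; push_cast; ring
  rw [this, Complex.add_re, Complex.ofReal_re, Complex.re_ofReal_mul, Complex.I_re, mul_zero,
    add_zero]

/-- Off the null line `x = 0` the function agrees with one of two continuous functions, chosen by
the sign of `x`. -/
theorem aestronglyMeasurable_hamiltonian_trial
    (hφ : ContDiff ℝ 2 φ) (hφx : ∀ p : ℝ × ℝ, HasDerivAt (fun x => φ (x, p.2)) (A p).1 p.1)
    (hφy : ∀ p : ℝ × ℝ, HasDerivAt (fun y => φ (p.1, y)) ((A p).2 - B * p.1) p.2)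
    (hh : ContDiff ℝ ∞ h) (h0 : ∀ t < 0, h t = 0)
    (h1 : ∀ t < 0, deriv h t = 0) (h2 : ∀ t < 0, deriv (deriv h) t = 0) :
    AEStronglyMeasurable (hamiltonian A w (trial a κ b c φ h)) volume := by
  have hE : ∀ ε, Continuous fun p => Complex.exp (trialExponent a κ φ ε p) *
      actionAmplitude a κ b c B w h ε p := by
    intro ε
    refine Continuous.mul ?_ (continuous_actionAmplitude hh h0 h1 h2 ε)
    have := hφ.continuous
    unfold trialExponent
    fun_prop
  have hM : StronglyMeasurable fun p : ℝ × ℝ => if 0 ≤ p.1 then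
      Complex.exp (trialExponent a κ φ 1 p) * actionAmplitude a κ b c B w h 1 p else
      Complex.exp (trialExponent a κ φ (-1) p) * actionAmplitude a κ b c B w h (-1) p :=
    StronglyMeasurable.ite (measurableSet_le measurable_const measurable_fst)
    (hE 1).stronglyMeasurable (hE (-1)).stronglyMeasurable
  refine hM.aestronglyMeasurable.congr ?_
  filter_upwards [ae_fst_ne_zero] with p hp
  rcases hp.lt_or_gt with hp | hp
  · rw [if_neg (not_le.2 hp), hamiltonian_congr A w (trial_eventuallyEq_of_neg hp),
      hamiltonian_trialHalf hφx hφy hh h0 h1 h2]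
  · rw [if_pos hp.le, hamiltonian_congr A w (trial_eventuallyEq_of_pos hp),
      hamiltonian_trialHalf hφx hφy hh h0 h1 h2]

theorem trialAmplitude_of_notMem {k l : ℝ} (hk : ∀ t, t ∉ Icc k l → h t = 0) (ε : ℝ)
    {p : ℝ × ℝ} (hp : p.2 ∉ Icc (Real.exp k) (Real.exp l)) : trialAmplitude b c h ε p = 0 := by
  simp [trialAmplitude, logPull_of_notMem hk _ hp]

theorem actionAmplitude_of_notMem {k l : ℝ} (hk : ∀ t, t ∉ Icc k l → h t = 0) (ε : ℝ)
    {p : ℝ × ℝ} (hp : p.2 ∉ Icc (Real.exp k) (Real.exp l)) :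
    actionAmplitude a κ b c B w h ε p = 0 := by
  have k1 := deriv_eq_zero_of_notMem_Icc hk
  have k2 := deriv_eq_zero_of_notMem_Icc k1
  have l1 := logPull_of_notMem (h := fun t => deriv h t - h t)
    (fun t ht => by simp [hk t ht, k1 t ht]) 2 hp
  have l2 := logPull_of_notMem (h := fun t => deriv (deriv h) t - deriv h t)
    (fun t ht => by simp [k2 t ht, k1 t ht]) 2 hp
  have l3 := logPull_of_notMem
    (h := fun t => deriv (deriv h) t - deriv h t - 2 * (deriv h t - h t))
    (fun t ht => by simp [k2 t ht, k1 t ht, hk t ht]) 3 hp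
  simp [actionAmplitude, trialAmplitude_of_notMem hk ε hp, trialAmplitudeX, trialAmplitudeY,
    trialAmplitudeYY, logPull_of_notMem hk _ hp, logPull_of_notMem k1 _ hp, l1, l2, l3]

/-- Pointwise bounds for the trial functions and their residuals. -/
theorem exists_trial_bounds (ha : 0 < a) (hκ0 : 0 < κ)
    (hκ : κ ^ 2 = a ^ 2 - w ^ 2) (hb : 2 * a * b = B * κ) (hc : a * c = b)
    (hφx : ∀ p : ℝ × ℝ, HasDerivAt (fun x => φ (x, p.2)) (A p).1 p.1)
    (hφy : ∀ p : ℝ × ℝ, HasDerivAt (fun y => φ (p.1, y)) ((A p).2 - B * p.1) p.2) (μ : ℝ) :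
    ∃ C : ℝ, 0 ≤ C ∧ ∀ k : ℝ, 1 ≤ k → 2 * (|b| + |c|) ≤ k → ∃ h : ℝ → ℂ, ContDiff ℝ ∞ h ∧
      (∀ t, t ∉ Icc k (2 * k) → h t = 0) ∧
      (∀ p : ℝ × ℝ, p.1 ≠ 0 → ‖trial a κ b c φ h p‖ ^ 2 ≤ C * stripWeight a k p) ∧
      (∀ p : ℝ × ℝ, p.1 ≠ 0 → ‖hamiltonian A w (trial a κ b c φ h) p -
        μ * trial a κ b c φ h p‖ ^ 2 ≤ C / k ^ 2 * stripWeight a k p) ∧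
      ∀ p : ℝ × ℝ, p.1 ≠ 0 → p ∈ hyperbolicStrip (5 / 4 * k) (7 / 4 * k) →
        Real.exp (-(2 * a)) / 4 ≤ ‖trial a κ b c φ h p‖ ^ 2 := by
  -- The frequency for which `exp(iσt)` solves `-2iκh' = μh`.
  obtain ⟨M, hM⟩ := exists_slow_wave (μ / (2 * κ))
  have hM0 : 0 ≤ M := by
    obtain ⟨h, -, -, h0, -⟩ := hM 1 le_rfl
    exact (norm_nonneg _).trans (h0 0)
  -- Growth `exp(a|s|/2)` against the decay `exp(-a|s|)` leaves `exp(-a|s|/2)`, whose square is the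
  -- weight `stripWeight a k`.
  obtain ⟨C, hC0, hC⟩ := exists_remainder_bound a κ b c B w μ M (half_pos ha)
  refine ⟨(2 * κ * M + C) ^ 2, by positivity, fun k hk hkb => ?_⟩
  obtain ⟨h, hh, hsupp, hn0, hn1, hn2, hres, hone⟩ := hM k hk
  have hk0 : 0 < k := by linarith
  have z0 : ∀ t < 0, h t = 0 := fun t ht => hsupp t fun h => by linarith [h.1]
  have s1 := deriv_eq_zero_of_notMem_Icc hsupp
  have s2 := deriv_eq_zero_of_notMem_Icc s1
  have z1 : ∀ t < 0, deriv h t = 0 := fun t ht => s1 t fun h => by linarith [h.1]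
  have z2 : ∀ t < 0, deriv (deriv h) t = 0 := fun t ht => s2 t fun h => by linarith [h.1]
  have hu : ∀ y : ℝ, Real.exp k ≤ y → 0 < y ∧ |y⁻¹| ≤ 1 ∧ (y⁻¹) ^ 2 ≤ 1 / k := by
    intro y hy
    -- On the support `y⁻²` is exponentially small in `k`; the crude bound `1/k` is enough, matching
    -- the cutoff error.
    have hyk : k ≤ y := (by linarith [Real.add_one_le_exp k] : k ≤ Real.exp k).trans hy
    have hy0 : 0 < y := hk0.trans_le hyk
    refine ⟨hy0, ?_, ?_⟩
    · rw [abs_of_pos (inv_pos.2 hy0)]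
      exact inv_le_one_of_one_le₀ (hk.trans hyk)
    · rw [inv_pow, ← one_div]
      exact one_div_le_one_div_of_le hk0 (by nlinarith)
  have hsq : ∀ (D s : ℝ), (D * Real.exp (-(a / 2 * s))) ^ 2 = D ^ 2 * Real.exp (-(a * s)) := by
    intro D s
    rw [mul_pow, ← Real.exp_nat_mul]
    congr 2
    push_cast
    ring
  have hexp : ∀ s : ℝ, Real.exp (-(a * s)) * Real.exp (a / 2 * s) = Real.exp (-(a / 2 * s)) := by
    intro s
    rw [← Real.exp_add]
    congr 1
    ring
  have habs : ∀ p : ℝ × ℝ, 0 < p.2 → |p.1 * p.2| = |p.1| * p.2 := fun p hp => by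
    rw [abs_mul, abs_of_pos hp]
  refine ⟨h, hh, hsupp, fun p hp => ?_, fun p hp => ?_, fun p hp hpm => ?_⟩
  · obtain ⟨ε, hε, hεp, he⟩ := exists_sign_trial_eventuallyEq (a := a) (κ := κ) (b := b) (c := c)
      (φ := φ) (h := h) hp
    rw [he.eq_of_nhds, trialHalf, norm_mul, norm_cexp_trialExponent hεp]
    by_cases hy : p.2 ∈ Icc (Real.exp k) (Real.exp (2 * k))
    · obtain ⟨hy0, hu1, -⟩ := hu _ hy.1
      have hb := (hC ε hε (p.1 * p.2) p.2⁻¹ (h (Real.log p.2)) 0 0 hu1 (hn0 _)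
        (by simpa) (by simpa)).2
      rw [← trialAmplitude_eq ε p hy0, habs p hy0] at hb
      rw [stripWeight, indicator_of_mem hy, mul_assoc a, ← hsq]
      refine pow_le_pow_left₀ (by positivity) ?_ 2
      calc _ ≤ Real.exp (-(a * (|p.1| * p.2))) * (C * Real.exp (a / 2 * (|p.1| * p.2))) := by gcongr
        _ = C * Real.exp (-(a / 2 * (|p.1| * p.2))) := by rw [← hexp]; ring
        _ ≤ _ := by
          gcongr
          have : 0 ≤ 2 * κ * M := by positivity
          linarith
    · rw [trialAmplitude_of_notMem hsupp ε hy, stripWeight, indicator_of_notMem hy]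
      simp
  · obtain ⟨ε, hε, hεp, he⟩ := exists_sign_trial_eventuallyEq (a := a) (κ := κ) (b := b) (c := c)
      (φ := φ) (h := h) hp
    rw [hamiltonian_congr A w he, hamiltonian_trialHalf hφx hφy hh z0 z1 z2, he.eq_of_nhds,
      trialHalf, mul_left_comm, ← mul_sub, norm_mul, norm_cexp_trialExponent hεp]
    by_cases hy : p.2 ∈ Icc (Real.exp k) (Real.exp (2 * k))
    · obtain ⟨hy0, hu1, hu2⟩ := hu _ hy.1
      have hb' := (hC ε hε (p.1 * p.2) p.2⁻¹ _ _ _ hu1 (hn0 (Real.log p.2)) (hn1 (Real.log p.2))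
        (hn2 (Real.log p.2))).1
      rw [habs p hy0] at hb'
      have hlead : ‖-(2 * Complex.I * κ) * deriv h (Real.log p.2) - μ * h (Real.log p.2)‖ ≤
          2 * κ * (M / k) := by
        have hκc : (κ : ℂ) ≠ 0 := by exact_mod_cast hκ0.ne'
        have : -(2 * Complex.I * κ) * deriv h (Real.log p.2) - μ * h (Real.log p.2) =
            -(2 * Complex.I * κ) * (deriv h (Real.log p.2) -
              Complex.I * (μ / (2 * κ) : ℝ) * h (Real.log p.2)) := by
          push_cast
          field_simp
          linear_combination (-μ * h (Real.log p.2)) * Complex.I_sq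
        rw [this, norm_mul]
        have h2 : ‖-(2 * Complex.I * (κ : ℂ))‖ = 2 * κ := by
          simp [abs_of_pos hκ0]
        rw [h2]
        gcongr
        exact hres _
      have hamp : ‖actionAmplitude a κ b c B w h ε p - μ * trialAmplitude b c h ε p‖ ≤
          (2 * κ * M + C) / k * Real.exp (a / 2 * (|p.1| * p.2)) := by
        rw [actionAmplitude_sub hκ hb hc μ hε p hy0]
        refine (norm_add_le _ _).trans ?_
        rw [norm_mul, norm_pow, Complex.norm_real, Real.norm_eq_abs, sq_abs]
        have h1e : 1 ≤ Real.exp (a / 2 * (|p.1| * p.2)) := Real.one_le_exp (by positivity)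
        calc _ ≤ 2 * κ * (M / k) * Real.exp (a / 2 * (|p.1| * p.2)) +
              1 / k * (C * Real.exp (a / 2 * (|p.1| * p.2))) := by
              refine add_le_add (hlead.trans (le_mul_of_one_le_right (by positivity) h1e)) ?_
              gcongr
          _ = _ := by ring
      have hD : (2 * κ * M + C) ^ 2 / k ^ 2 = ((2 * κ * M + C) / k) ^ 2 := by rw [div_pow]
      rw [stripWeight, indicator_of_mem hy, mul_assoc a, hD, ← hsq]
      refine pow_le_pow_left₀ (by positivity) ?_ 2
      calc _ ≤ Real.exp (-(a * (|p.1| * p.2))) *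
            ((2 * κ * M + C) / k * Real.exp (a / 2 * (|p.1| * p.2))) := by gcongr
        _ = _ := by rw [← hexp]; ring
    · rw [trialAmplitude_of_notMem hsupp ε hy, actionAmplitude_of_notMem hsupp ε hy, stripWeight,
        indicator_of_notMem hy]
      simp
  · obtain ⟨ε, hε, hεp, he⟩ := exists_sign_trial_eventuallyEq (a := a) (κ := κ) (b := b) (c := c)
      (φ := φ) (h := h) hp
    obtain ⟨hy, hxy⟩ := hpm
    obtain ⟨hy0, hu1, hu2⟩ := hu p.2 ((Real.exp_le_exp.2 (by linarith)).trans hy.1)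
    have hlog : Real.log p.2 ∈ Icc (5 / 4 * k) (7 / 4 * k) :=
      ⟨(Real.le_log_iff_exp_le hy0).2 hy.1, (Real.log_le_iff_le_exp hy0).2 hy.2⟩
    rw [he.eq_of_nhds, trialHalf, norm_mul, norm_cexp_trialExponent hεp,
      trialAmplitude_eq ε p hy0, norm_mul, hone _ hlog, one_mul]
    have hs : |p.1 * p.2| ≤ 1 := by rwa [habs p hy0]
    have hεn : |ε| = 1 := by rcases hε with rfl | rfl <;> simp
    -- Under the hyperbola `|s| ≤ 1`, so `k ≥ 2(|b| + |c|)` keeps the corrections below half of the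
    -- leading amplitude.
    have hsmall : ‖((p.2⁻¹ : ℝ) : ℂ) ^ 2 *
        (ε * b * ((p.1 * p.2 : ℝ) : ℂ) ^ 2 + c * ((p.1 * p.2 : ℝ) : ℂ))‖ ≤ 1 / 2 := by
      rw [norm_mul, norm_pow, Complex.norm_real, Real.norm_eq_abs, sq_abs]
      calc _ ≤ 1 / k * (|b| + |c|) := by
            gcongr
            refine (norm_add_le _ _).trans ?_
            rw [norm_mul, norm_mul, norm_mul, norm_pow]
            simp only [Complex.norm_real, Real.norm_eq_abs]
            rw [hεn, one_mul]
            refine add_le_add ?_ ?_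
            · exact mul_le_of_le_one_right (abs_nonneg _) (pow_le_one₀ (abs_nonneg _) hs)
            · exact mul_le_of_le_one_right (abs_nonneg _) hs
        _ ≤ 1 / 2 := by
            rw [one_div_mul_eq_div, div_le_iff₀ hk0]
            linarith
    have hlow : 1 / 2 ≤ ‖1 + ((p.2⁻¹ : ℝ) : ℂ) ^ 2 *
        (ε * b * ((p.1 * p.2 : ℝ) : ℂ) ^ 2 + c * ((p.1 * p.2 : ℝ) : ℂ))‖ := by
      have := norm_sub_le_norm_add (1 : ℂ) (((p.2⁻¹ : ℝ) : ℂ) ^ 2 *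
        (ε * b * ((p.1 * p.2 : ℝ) : ℂ) ^ 2 + c * ((p.1 * p.2 : ℝ) : ℂ)))
      rw [norm_one] at this
      linarith
    have he1 : Real.exp (-a) ≤ Real.exp (-(a * (|p.1| * p.2))) := by
      refine Real.exp_le_exp.2 (neg_le_neg ?_)
      exact mul_le_of_le_one_right ha.le hxy
    calc Real.exp (-(2 * a)) / 4 = (Real.exp (-a) * (1 / 2)) ^ 2 := by
          rw [mul_pow, ← Real.exp_nat_mul]
          push_cast
          rw [show (2 : ℝ) * -a = -(2 * a) by ring]
          ring
      _ ≤ _ := by gcongr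

end Weyl

/-- Approximate eigenfunctions in the initial domain at every real energy. -/
theorem exists_approximate_eigenfunction {B ω lam : ℝ} {A : ℝ × ℝ → ℝ × ℝ} (hω : 0 < ω) (hlam : lam < -2 * ω)
    (hA : IsVectorPotential B A) (μ : ℝ) {e : ℝ} (he : 0 < e) :
    ∃ (v : ℝ × ℝ → ℂ) (hv : MemD0 A ω lam v), hv.memLp.toLp v ≠ 0 ∧
      ‖hv.memLp_hamiltonian.toLp (hamiltonian A ω v) - (μ : ℂ) • hv.memLp.toLp v‖ ≤
        e * ‖hv.memLp.toLp v‖ := by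
  obtain ⟨φ, hφ, hφx, hφy⟩ := hA.exists_gauge
  obtain ⟨a, rfl⟩ : ∃ a, lam = -2 * a := ⟨-lam / 2, by ring⟩
  have haω : ω < a := by linarith
  have ha : 0 < a := hω.trans haω
  have hpos : 0 < a ^ 2 - ω ^ 2 := by nlinarith
  obtain ⟨κ, hκ0, hκ⟩ : ∃ κ, 0 < κ ∧ κ ^ 2 = a ^ 2 - ω ^ 2 :=
    ⟨√(a ^ 2 - ω ^ 2), Real.sqrt_pos.2 hpos, Real.sq_sqrt hpos.le⟩
  obtain ⟨b, hb⟩ : ∃ b, 2 * a * b = B * κ := ⟨B * κ / (2 * a), by field_simp⟩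
  obtain ⟨c, hc⟩ : ∃ c, a * c = b := ⟨b / a, by field_simp⟩
  obtain ⟨C, hC0, hC⟩ := exists_trial_bounds ha hκ0 hκ hb hc hφx hφy μ
  set m := Real.exp (-(2 * a)) / 4 with hm
  have hm0 : 0 < m := by positivity
  -- The squared residual is at most `2C/(ak)` and the squared norm at least `mk`, so `2C/(ame²) ≤
  -- k²` is needed; this follows from the third bound since `k ≥ 1`.
  obtain ⟨k, hk⟩ : ∃ k, max (max 1 (2 * (|b| + |c|))) (2 * C / (a * m * e ^ 2)) ≤ k := ⟨_, le_rfl⟩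
  have hk1 : 1 ≤ k := (le_max_left _ _).trans ((le_max_left _ _).trans hk)
  have hk2 : 2 * (|b| + |c|) ≤ k := (le_max_right _ _).trans ((le_max_left _ _).trans hk)
  have hk3 : 2 * C / (a * m * e ^ 2) ≤ k := (le_max_right _ _).trans hk
  have hk0 : 0 < k := by linarith
  obtain ⟨h, hh, hsupp, hv, hr, hlow⟩ := hC k hk1 hk2
  have z0 : ∀ t < 0, h t = 0 := fun t ht => hsupp t fun h => by linarith [h.1]
  have s1 := deriv_eq_zero_of_notMem_Icc hsupp
  have s2 := deriv_eq_zero_of_notMem_Icc s1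
  have z1 : ∀ t < 0, deriv h t = 0 := fun t ht => s1 t fun h => by linarith [h.1]
  have z2 : ∀ t < 0, deriv (deriv h) t = 0 := fun t ht => s2 t fun h => by linarith [h.1]
  have hvae := ae_fst_ne_zero.mono hv
  have hrae := ae_fst_ne_zero.mono hr
  have hmv := (continuous_trial (a := a) (κ := κ) (b := b) (c := c) hφ hh z0).aestronglyMeasurable
    (μ := volume)
  have hmh := aestronglyMeasurable_hamiltonian_trial (a := a) (κ := κ) (b := b) (c := c) (w := ω)
    hφ hφx hφy hh z0 z1 z2
  have hL := memLp_of_stripWeight ha hk0.le hmv hvae hC0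
  have hLr : MemLp (fun p => hamiltonian A ω (trial a κ b c φ h) p -
      μ * trial a κ b c φ h p) 2 volume :=
    memLp_of_stripWeight ha hk0.le (hmh.sub (hmv.const_mul (μ : ℂ))) hrae (by positivity)
  have hLh : MemLp (hamiltonian A ω (trial a κ b c φ h)) 2 volume := by
    convert! hLr.add (hL.const_mul (μ : ℂ)) using 1
    ext p
    simp
  have hD := memD0_trial hφ hφx hA.contDiff.continuous hh z0 hL hLh
  have n1 := norm_toLp_sq_le_of_stripWeight ha hk0.le hLr hrae (by positivity)
  have n2 := le_norm_toLp_sq (by linarith) hm0.le hL (ae_fst_ne_zero.mono hlow)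
  have n2' : m * k ≤ ‖hL.toLp (trial a κ b c φ h)‖ ^ 2 := by
    refine le_trans (le_of_eq ?_) n2
    ring
  refine ⟨_, hD, ?_, ?_⟩
  · intro h0
    rw [h0, norm_zero] at n2'
    have : 0 < m * k := by positivity
    norm_num at n2'
    linarith
  · have heq : hD.memLp_hamiltonian.toLp (hamiltonian A ω (trial a κ b c φ h)) -
        (μ : ℂ) • hD.memLp.toLp (trial a κ b c φ h) = hLr.toLp _ := rfl
    rw [heq]
    refine abs_le_of_sq_le_sq' ?_ (by positivity) |>.2
    rw [mul_pow]
    refine n1.trans (le_trans ?_ (mul_le_mul_of_nonneg_left n2' (sq_nonneg e)))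
    rw [div_le_iff₀ (by positivity)] at hk3
    have hlhs : C / k ^ 2 * (2 / a * k) = 2 * C / (a * k) := by field_simp
    rw [hlhs, div_le_iff₀ (by positivity)]
    calc 2 * C ≤ k * (a * m * e ^ 2) * 1 := by linarith
      _ ≤ k * (a * m * e ^ 2) * k := by gcongr
      _ = _ := by ring

end Smilansky

end

theorem mainTheorem1 (ω B lam : ℝ) (hω : 0 < ω) (hB : 0 < B) (hlam : lam < -2 * ω)
    (A : ℝ × ℝ → ℝ × ℝ) (hA : Smilansky.IsVectorPotential B A)
    (T : Smilansky.L2Plane →ₗ.[ℂ] Smilansky.L2Plane)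
    (hT : Smilansky.IsSelfAdjointExtension A ω lam T) :
    Smilansky.unboundedSpectrum T = Set.range (fun t : ℝ => (t : ℂ)) := by
  ext z
  constructor
  · intro hz
    refine ⟨z.re, ?_⟩
    by_contra hne
    refine hz (Smilansky.inResolventSet_of_im_ne_zero hT.isSelfAdjoint fun him => hne ?_)
    exact Complex.ext (by simp) (by simp [him])
  · rintro ⟨μ, rfl⟩
    refine Smilansky.not_inResolventSet_of_approx fun e he => ?_
    obtain ⟨v, hv, hv0, hle⟩ := Smilansky.exists_approximate_eigenfunction hω hlam hA μ he
    obtain ⟨hmem, happ⟩ := hT.extends_D0 v hv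
    refine ⟨⟨_, hmem⟩, hv0, ?_⟩
    rw [happ]
    exact hle
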